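/- Let $p$ be a prime and $h\ge 1$ an integer. Let $H$ be a (commutative, one-parameter) formal group law over $\mathbb F_p$ with $[p]_H(T)=T^{p^h}$. For $n\ge 1$ let $H^{(n)}$ be its truncation to an $n$-bud law, i.e. the class of $H(T_1,T_2)$ in $\mathbb F_p[T_1,T_2]/(T_1,T_2)^{n+1}$. For an $\mathbb F_p$-scheme $S$ with ring of global sections $\Gamma(S)$, let $\mathcal{A}ut(H^{(n)})(S)$ be the group, under composition, of automorphisms of $H^{(n)}$ over $\Gamma(S)$: the composition-invertible $f(T)=a_1T+\dots+a_nT^n\in\Gamma(S)[T]/(T)^{n+1}$ with $f(H^{(n)}(T_1,T_2))=H^{(n)}(f(T_1),f(T_2))$ in $\Gamma(S)[T_1,T_2]/(T_1,T_2)^{n+1}$. Put $\mathcal A_0=\mathcal{A}ut(H^{(n)})$ and, for $1\le i\le n$, let $\mathcal A_i(S)\subset\mathcal A_0(S)$ be the normal subgroup of those $f$ of the form $T+a_{i+1}T^{i+1}+\dots+a_nT^n$ (so $\mathcal A_n=1$). Theorem. Let $n\ge p^{h+1}$, and let $l$ be the integer with $p^l\le n<p^{l+1}$. For $0\le i\le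 n-1$, the presheaf of groups $S\mapsto \mathcal A_i(S)/\mathcal A_{i+1}(S)$ on $\mathbb F_p$-schemes is isomorphic to $$\begin{cases}\mu_{p^h-1}, & i=0;\\ \mathbb G_a^{\mathrm{Fr}_{p^h}}, & i=p^j-1,\ 1\le j\le l-h;\\ \mathbb G_a, & i=p^j-1,\ l-h<j\le l;\\ 0, & \text{otherwise,}\end{cases}$$ where, in the first three cases, the isomorphism is the one induced by $f\mapsto$ the coefficient $a_{i+1}$ of $T^{i+1}$ in $f(T)$. Here $\mu_{p^h-1}(S)=\{a\in\Gamma(S)^\times : a^{p^h-1}=1\}$, $\mathbb G_a(S)=\Gamma(S)$ (under addition), and $\mathbb G_a^{\mathrm{Fr}_{p^h}}(S)=\{a\in\Gamma(S): a^{p^h}=a\}$. -/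

import Mathlib

open CategoryTheory AlgebraicGeometry Opposite

universe u

noncomputable section

/-- The truncated polynomial ring `R[T_s : s ∈ σ] / (T_s : s ∈ σ)^(n+1)`. -/
def TruncPoly (σ : Type*) (n : ℕ) (R : Type*) [CommRing R] : Type _ :=
  MvPolynomial σ R ⧸ (MvPolynomial.idealOfVars σ R) ^ (n + 1)

namespace TruncPoly

instance (σ : Type*) (n : ℕ) (R : Type*) [CommRing R] : CommRing (TruncPoly σ n R) :=
  inferInstanceAs (CommRing (MvPolynomial σ R ⧸ (MvPolynomial.idealOfVars σ R) ^ (n + 1)))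

instance (σ : Type*) (n : ℕ) (R : Type*) [CommRing R] : Algebra R (TruncPoly σ n R) :=
  inferInstanceAs (Algebra R (MvPolynomial σ R ⧸ (MvPolynomial.idealOfVars σ R) ^ (n + 1)))

/-- The quotient map `R[T_s : s ∈ σ] → R[T_s : s ∈ σ] / (T_s : s ∈ σ)^(n+1)`. -/
def mk (σ : Type*) (n : ℕ) (R : Type*) [CommRing R] :
    MvPolynomial σ R →ₐ[R] TruncPoly σ n R :=
  Ideal.Quotient.mkₐ R ((MvPolynomial.idealOfVars σ R) ^ (n + 1))

/-- The ideal of truncated polynomials with zero constant term. -/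
def aug (σ : Type*) (n : ℕ) (R : Type*) [CommRing R] : Ideal (TruncPoly σ n R) :=
  (MvPolynomial.idealOfVars σ R).map (mk σ n R)

section

variable {σ τ υ : Type*} {n : ℕ} {R S : Type*} [CommRing R] [CommRing S]

lemma mk_surjective : Function.Surjective (mk σ n R) := Ideal.Quotient.mk_surjective

lemma mk_eq_zero_iff (q : MvPolynomial σ R) :
    mk σ n R q = 0 ↔ q ∈ (MvPolynomial.idealOfVars σ R) ^ (n + 1) :=
  Ideal.Quotient.eq_zero_iff_mem

lemma aug_pow : aug σ n R ^ (n + 1) = ⊥ := by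
  rw [aug, ← Ideal.map_pow, Ideal.map_eq_bot_iff_le_ker]
  exact fun q hq => (mk_eq_zero_iff q).2 hq

/-- The variable `T_s`. -/
def T (s : σ) : aug σ n R :=
  ⟨mk σ n R (MvPolynomial.X s),
    Ideal.mem_map_of_mem _ (Ideal.subset_span (Set.mem_range_self s))⟩

lemma coe_T (s : σ) : ((T s : aug σ n R) : TruncPoly σ n R) = mk σ n R (MvPolynomial.X s) := rfl

/-- Substitution `f ↦ f(g)` of truncated polynomials `g` with zero constant term. -/
def subst (g : σ → aug τ n R) : TruncPoly σ n R →ₐ[R] TruncPoly τ n R :=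
  Ideal.Quotient.liftₐ _ (MvPolynomial.aeval fun s => (g s : TruncPoly τ n R)) (by
    have h1 : (MvPolynomial.idealOfVars σ R).map
        (MvPolynomial.aeval fun s => (g s : TruncPoly τ n R)) ≤ aug τ n R := by
      rw [Ideal.map_span, Ideal.span_le]
      rintro _ ⟨_, ⟨s, rfl⟩, rfl⟩
      simp
    intro a ha
    have h2 := Ideal.mem_map_of_mem (MvPolynomial.aeval fun s => (g s : TruncPoly τ n R)) ha
    rw [Ideal.map_pow] at h2
    have h3 := Ideal.pow_right_mono h1 (n + 1) h2
    rwa [aug_pow, Ideal.mem_bot] at h3)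

@[simp] lemma subst_mk (g : σ → aug τ n R) (q : MvPolynomial σ R) :
    subst g (mk σ n R q) = MvPolynomial.aeval (fun s => (g s : TruncPoly τ n R)) q := rfl

@[simp] lemma subst_T (g : σ → aug τ n R) (s : σ) :
    subst g ((T s : aug σ n R) : TruncPoly σ n R) = g s := by
  rw [coe_T, subst_mk, MvPolynomial.aeval_X]

lemma algHom_ext {A : Type*} [CommRing A] [Algebra R A] {f g : TruncPoly σ n R →ₐ[R] A}
    (h : ∀ s, f ((T s : aug σ n R) : TruncPoly σ n R) =
      g ((T s : aug σ n R) : TruncPoly σ n R)) : f = g := by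
  have h1 : f.comp (mk σ n R) = g.comp (mk σ n R) := MvPolynomial.algHom_ext h
  ext x
  obtain ⟨q, rfl⟩ := mk_surjective x
  exact DFunLike.congr_fun h1 q

lemma map_subst_aug_le (g : σ → aug τ n R) : (aug σ n R).map (subst g) ≤ aug τ n R := by
  rw [aug, Ideal.map_span, Ideal.map_span, Ideal.span_le]
  rintro _ ⟨_, ⟨_, ⟨s, rfl⟩, rfl⟩, rfl⟩
  simp

lemma subst_mem_aug_pow (g : σ → aug τ n R) (k : ℕ) {f : TruncPoly σ n R}
    (hf : f ∈ aug σ n R ^ k) : subst g f ∈ aug τ n R ^ k := by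
  have h := Ideal.mem_map_of_mem (subst g) hf
  rw [Ideal.map_pow] at h
  exact Ideal.pow_right_mono (map_subst_aug_le g) k h

/-- Substitution, restricted to truncated polynomials with zero constant term. -/
def substAug (g : σ → aug τ n R) (f : aug σ n R) : aug τ n R :=
  ⟨subst g f, map_subst_aug_le g (Ideal.mem_map_of_mem _ f.2)⟩

@[simp] lemma coe_substAug (g : σ → aug τ n R) (f : aug σ n R) :
    (substAug g f : TruncPoly τ n R) = subst g f := rfl

lemma subst_subst (g : τ → aug υ n R) (f : σ → aug τ n R) (a : TruncPoly σ n R) :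
    subst g (subst f a) = subst (fun s => substAug g (f s)) a := by
  have : (subst g).comp (subst f) = subst (fun s => substAug g (f s)) :=
    algHom_ext fun s => by simp
  exact DFunLike.congr_fun this a

lemma subst_self (a : TruncPoly σ n R) : subst T a = a := by
  have : subst T = AlgHom.id R (TruncPoly σ n R) := algHom_ext fun s => by simp
  exact DFunLike.congr_fun this a

/-- Application of a ring homomorphism to the coefficients. -/
def map (φ : R →+* S) : TruncPoly σ n R →+* TruncPoly σ n S :=
  Ideal.Quotient.lift _ ((mk σ n S : MvPolynomial σ S →+* TruncPoly σ n S).comp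
    (MvPolynomial.map φ)) (by
    intro a ha
    change mk σ n S (MvPolynomial.map φ a) = 0
    rw [mk_eq_zero_iff]
    rw [MvPolynomial.mem_pow_idealOfVars_iff'] at ha ⊢
    intro x hx
    rw [MvPolynomial.coeff_map, ha x hx, map_zero])

@[simp] lemma map_mk (φ : R →+* S) (q : MvPolynomial σ R) :
    map φ (mk σ n R q) = mk σ n S (MvPolynomial.map φ q) := rfl

@[simp] lemma map_T (φ : R →+* S) (s : σ) :
    map φ ((T s : aug σ n R) : TruncPoly σ n R) = ((T s : aug σ n S) : TruncPoly σ n S) := by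
  rw [coe_T, coe_T, map_mk, MvPolynomial.map_X]

lemma map_aug_le (φ : R →+* S) : (aug σ n R).map (map φ) ≤ aug σ n S := by
  rw [aug, Ideal.map_span, Ideal.map_span, Ideal.span_le]
  rintro _ ⟨_, ⟨_, ⟨s, rfl⟩, rfl⟩, rfl⟩
  rw [map_mk, MvPolynomial.map_X]
  exact (T s).2

lemma map_mem_aug_pow (φ : R →+* S) (k : ℕ) {f : TruncPoly σ n R}
    (hf : f ∈ aug σ n R ^ k) : map φ f ∈ aug σ n S ^ k := by
  have h := Ideal.mem_map_of_mem (map φ) hf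
  rw [Ideal.map_pow] at h
  exact Ideal.pow_right_mono (map_aug_le φ) k h

/-- Application of a ring homomorphism to the coefficients, for zero constant term. -/
def mapAug (φ : R →+* S) (f : aug σ n R) : aug σ n S :=
  ⟨map φ f, map_aug_le φ (Ideal.mem_map_of_mem _ f.2)⟩

@[simp] lemma coe_mapAug (φ : R →+* S) (f : aug σ n R) :
    (mapAug φ f : TruncPoly σ n S) = map φ f := rfl

lemma map_algebraMap (φ : R →+* S) (r : R) :
    map φ (algebraMap R (TruncPoly σ n R) r) = algebraMap S (TruncPoly σ n S) (φ r) := by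
  rw [← (mk σ n R).commutes, ← (mk σ n S).commutes, map_mk, MvPolynomial.algebraMap_eq,
    MvPolynomial.algebraMap_eq, MvPolynomial.map_C]

lemma map_subst (φ : R →+* S) (g : σ → aug τ n R) (a : TruncPoly σ n R) :
    map φ (subst g a) = subst (fun s => mapAug φ (g s)) (map φ a) := by
  obtain ⟨q, rfl⟩ := mk_surjective a
  induction q using MvPolynomial.induction_on with
  | C r =>
    rw [← MvPolynomial.algebraMap_eq, AlgHom.commutes, AlgHom.commutes, map_algebraMap,
      map_algebraMap, AlgHom.commutes]
  | add a b ha hb => simp only [map_add, ha, hb]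
  | mul_X a s ha =>
    simp only [map_mul, ha]
    congr 1
    rw [← coe_T, subst_T, map_T, subst_T]
    rfl

lemma map_map {A : Type*} [CommRing A] (φ : R →+* S) (ψ : S →+* A) (a : TruncPoly σ n R) :
    map ψ (map φ a) = map (ψ.comp φ) a := by
  obtain ⟨q, rfl⟩ := mk_surjective a
  simp only [map_mk, MvPolynomial.map_map]

lemma map_id (a : TruncPoly σ n R) : map (RingHom.id R) a = a := by
  obtain ⟨q, rfl⟩ := mk_surjective a
  rw [map_mk, MvPolynomial.map_id]

/-- The coefficient of the monomial `T^d`; by convention it is `0` if `d` has degree `> n`. -/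
def coeff (d : σ →₀ ℕ) : TruncPoly σ n R →+ R :=
  QuotientAddGroup.lift ((MvPolynomial.idealOfVars σ R ^ (n + 1)).toAddSubgroup)
    (if d.degree ≤ n then MvPolynomial.coeffAddMonoidHom d else 0) (by
      intro a ha
      have ha : a ∈ MvPolynomial.idealOfVars σ R ^ (n + 1) := ha
      rw [MvPolynomial.mem_pow_idealOfVars_iff'] at ha
      split_ifs with h
      · exact ha d (by lia)
      · simp)

lemma coeff_mk (d : σ →₀ ℕ) (q : MvPolynomial σ R) (hd : d.degree ≤ n) :
    coeff d (mk σ n R q) = q.coeff d := by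
  change (if d.degree ≤ n then MvPolynomial.coeffAddMonoidHom d else 0 :
    MvPolynomial σ R →+ R) q = _
  rw [if_pos hd]
  rfl

/-- Truncation of a power series: all terms of degree `≥ n + 1` are discarded. -/
def ofPowerSeries [Finite σ] (n : ℕ) (f : MvPowerSeries σ R) : TruncPoly σ n R :=
  mk σ n R (MvPowerSeries.truncTotal (n + 1) f)

lemma ofPowerSeries_mem_aug [Finite σ] {f : MvPowerSeries σ R} (hf : f.constantCoeff = 0) :
    ofPowerSeries n f ∈ aug σ n R := by
  apply Ideal.mem_map_of_mem
  rw [← pow_one (MvPolynomial.idealOfVars σ R), MvPolynomial.mem_pow_idealOfVars_iff']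
  intro x hx
  obtain rfl : x = 0 := by
    rw [← Finsupp.degree_eq_zero_iff]
    lia
  rw [MvPowerSeries.coeff_truncTotal _ (by simp)]
  simpa using hf

/-- Truncation of power series as an algebra homomorphism. -/
def ofPowerSeriesHom [Finite σ] (n : ℕ) : MvPowerSeries σ R →ₐ[R] TruncPoly σ n R :=
  (MvPowerSeries.truncTotalAlgHom σ R (n + 1)).restrictScalars R

lemma ofPowerSeriesHom_apply [Finite σ] (f : MvPowerSeries σ R) :
    ofPowerSeriesHom n f = ofPowerSeries n f := rfl

lemma ofPowerSeries_aeval [Finite τ] (g : σ → MvPowerSeries τ R) (q : MvPolynomial σ R) :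
    ofPowerSeries n (MvPolynomial.aeval g q) =
      MvPolynomial.aeval (fun s => ofPowerSeries n (g s)) q := by
  have : (ofPowerSeriesHom n).comp (MvPolynomial.aeval g) =
      MvPolynomial.aeval (fun s => ofPowerSeries n (g s)) :=
    MvPolynomial.algHom_ext fun s => by simp [ofPowerSeriesHom_apply]
  exact DFunLike.congr_fun this q

lemma ofPowerSeries_coe [Finite σ] (q : MvPolynomial σ R) :
    ofPowerSeries n (q : MvPowerSeries σ R) = mk σ n R q :=
  (MvPowerSeries.truncTotalAlgHom σ R (n + 1)).commutes q

lemma ofPowerSeries_truncTotal [Finite σ] (f : MvPowerSeries σ R) :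
    ofPowerSeries n ((MvPowerSeries.truncTotal (n + 1) f : MvPolynomial σ R) :
      MvPowerSeries σ R) = ofPowerSeries n f := by
  rw [ofPowerSeries_coe]
  rfl

lemma ofPowerSeries_subst [Finite σ] [Finite τ] (f : MvPowerSeries σ R)
    (g : σ → MvPowerSeries τ R) (hg : ∀ s, (g s).constantCoeff = 0) :
    ofPowerSeries n (f.subst g) =
      subst (fun s => ⟨ofPowerSeries n (g s), ofPowerSeries_mem_aug (hg s)⟩)
        (ofPowerSeries n f) := by
  conv_lhs => rw [ofPowerSeries, MvPowerSeries.truncTotal_subst hg]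
  rw [MvPowerSeries.subst_coe]
  change ofPowerSeries n _ = _
  rw [ofPowerSeries_aeval]
  simp only [ofPowerSeries_truncTotal]
  rfl

lemma ofPowerSeries_X [Finite σ] (s : σ) :
    ofPowerSeries n (MvPowerSeries.X s : MvPowerSeries σ R) =
      ((T s : aug σ n R) : TruncPoly σ n R) := by
  rw [← MvPolynomial.coe_X, ofPowerSeries_coe]
  rfl

lemma ofPowerSeries_zero [Finite σ] : ofPowerSeries n (0 : MvPowerSeries σ R) = 0 :=
  map_zero (ofPowerSeriesHom (σ := σ) (R := R) n)

lemma constantCoeff_eq_zero_of_ofPowerSeries_mem [Finite σ] {f : MvPowerSeries σ R}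
    (hf : ofPowerSeries n f ∈ aug σ n R) : f.constantCoeff = 0 := by
  have h0 : ∀ x ∈ aug σ n R, coeff 0 x = 0 := by
    have hle : MvPolynomial.idealOfVars σ R ^ 1 =
        MvPolynomial.idealOfVars σ R := pow_one _
    intro x hx
    obtain ⟨q, hq, rfl⟩ := (Ideal.mem_map_iff_of_surjective (mk σ n R) mk_surjective).1 hx
    rw [coeff_mk _ _ (by simp)]
    rw [← hle, MvPolynomial.mem_pow_idealOfVars_iff'] at hq
    exact hq 0 (by simp)
  have h1 := h0 _ hf
  rw [ofPowerSeries, coeff_mk _ _ (by simp), MvPowerSeries.coeff_truncTotal _ (by simp)] at h1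
  simpa using h1

lemma ofPowerSeries_subst_pair [Finite τ] (f : MvPowerSeries (Fin 2) R)
    (a b : MvPowerSeries τ R) (a' b' : aug τ n R) (ha : ofPowerSeries n a = a')
    (hb : ofPowerSeries n b = b') :
    ofPowerSeries n (f.subst ![a, b]) = subst ![a', b'] (ofPowerSeries n f) := by
  have ha0 : a.constantCoeff = 0 :=
    constantCoeff_eq_zero_of_ofPowerSeries_mem (n := n) (ha ▸ a'.2)
  have hb0 : b.constantCoeff = 0 :=
    constantCoeff_eq_zero_of_ofPowerSeries_mem (n := n) (hb ▸ b'.2)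
  rw [ofPowerSeries_subst f ![a, b] (by
    intro s
    fin_cases s
    · exact ha0
    · exact hb0)]
  congr 2
  funext s
  apply Subtype.ext
  fin_cases s
  · exact ha
  · exact hb

end

end TruncPoly

open TruncPoly in
/-- A (commutative, one-parameter) `n`-bud law over `R`: a truncated polynomial
`F(T₀, T₁) ∈ R[T₀, T₁]/(T₀, T₁)^(n+1)` satisfying the identity, associativity and commutativity
axioms.  (The constant term vanishes by the identity axiom; this is built into the type.) -/
@[ext]
structure BudLaw (n : ℕ) (R : Type*) [CommRing R] where
  /-- The truncated polynomial `F(T₀, T₁)`. -/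
  law : aug (Fin 2) n R
  /-- `F(T, 0) = T`. -/
  right_id : substAug ![T (), 0] law = T ()
  /-- `F(0, T) = T`. -/
  left_id : substAug ![0, T ()] law = T ()
  /-- `F(F(T₀, T₁), T₂) = F(T₀, F(T₁, T₂))`. -/
  assoc : substAug ![substAug ![T (0 : Fin 3), T 1] law, T 2] law =
    substAug ![T 0, substAug ![T 1, T 2] law] law
  /-- `F(T₁, T₀) = F(T₀, T₁)`. -/
  comm : substAug ![T 1, T 0] law = law

open TruncPoly in
/-- A truncated polynomial `f(T) = a₁ T + ⋯ + aₙ Tⁿ ∈ R[T]/(T)^(n+1)` in one variable with zero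
constant term. -/
@[ext]
structure TruncEnd (n : ℕ) (R : Type*) [CommRing R] where
  /-- The underlying truncated polynomial. -/
  poly : aug Unit n R

namespace TruncEnd

open TruncPoly

section

variable {n : ℕ} {R S : Type*} [CommRing R] [CommRing S]

/-- Composition: `(f * g)(T) = f(g(T))`. -/
instance : Mul (TruncEnd n R) := ⟨fun f g => ⟨substAug (fun _ => g.poly) f.poly⟩⟩

/-- The identity `T`. -/
instance : One (TruncEnd n R) := ⟨⟨T ()⟩⟩

@[simp] lemma mul_poly (f g : TruncEnd n R) :
    (f * g).poly = substAug (fun _ => g.poly) f.poly := rfl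

@[simp] lemma one_poly : (1 : TruncEnd n R).poly = T () := rfl

lemma ext_coe {f g : TruncEnd n R}
    (h : (f.poly : TruncPoly Unit n R) = (g.poly : TruncPoly Unit n R)) : f = g :=
  TruncEnd.ext (Subtype.ext h)

/-- The truncated polynomials with zero constant term form a monoid under composition. -/
instance : Monoid (TruncEnd n R) where
  mul_assoc f g k := by
    apply ext_coe
    simp only [mul_poly, coe_substAug, subst_subst]
  one_mul f := by
    apply ext_coe
    simp only [mul_poly, one_poly, coe_substAug, subst_T]
  mul_one f := by
    apply ext_coe
    simp only [mul_poly, one_poly, coe_substAug]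
    exact subst_self (f.poly : TruncPoly Unit n R)

/-- The coefficient of `T^k` in `f(T)`. -/
def coeff (f : TruncEnd n R) (k : ℕ) : R :=
  TruncPoly.coeff (Finsupp.single () k) (f.poly : TruncPoly Unit n R)

/-- Application of a ring homomorphism to the coefficients. -/
def map (φ : R →+* S) : TruncEnd n R →* TruncEnd n S where
  toFun f := ⟨mapAug φ f.poly⟩
  map_one' := TruncEnd.ext (Subtype.ext (map_T φ ()))
  map_mul' f g := TruncEnd.ext (Subtype.ext (map_subst φ _ _))

@[simp] lemma map_poly (φ : R →+* S) (f : TruncEnd n R) :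
    (map φ f).poly = mapAug φ f.poly := rfl

/-- `f ≡ T` modulo `(T)^k`. -/
def IsCloseToId (k : ℕ) (f : TruncEnd n R) : Prop :=
  (f.poly : TruncPoly Unit n R) - (T () : aug Unit n R) ∈ aug Unit n R ^ k

lemma IsCloseToId.one (k : ℕ) : IsCloseToId k (1 : TruncEnd n R) := by
  simp [IsCloseToId]

lemma IsCloseToId.mul {k : ℕ} {f g : TruncEnd n R} (hf : IsCloseToId k f)
    (hg : IsCloseToId k g) : IsCloseToId k (f * g) := by
  have h := add_mem (subst_mem_aug_pow (fun _ => g.poly) k hf) hg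
  rw [map_sub, subst_T] at h
  simpa [IsCloseToId] using h

lemma IsCloseToId.of_mul_eq_one {k : ℕ} {f g : TruncEnd n R} (hf : IsCloseToId k f)
    (hfg : f * g = 1) : IsCloseToId k g := by
  have h := neg_mem (subst_mem_aug_pow (fun _ => g.poly) k hf)
  have h2 : subst (fun _ => g.poly) (f.poly : TruncPoly Unit n R) = (T () : aug Unit n R) :=
    congrArg (fun x : TruncEnd n R => (x.poly : TruncPoly Unit n R)) hfg
  rw [map_sub, subst_T, h2, neg_sub] at h
  exact h

lemma IsCloseToId.conj {k : ℕ} {f g g' : TruncEnd n R} (hf : IsCloseToId k f)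
    (hg : g * g' = 1) : IsCloseToId k (g * f * g') := by
  have h1 : subst (fun _ => f.poly) (g.poly : TruncPoly Unit n R) -
      (g.poly : TruncPoly Unit n R) ∈ aug Unit n R ^ k := by
    have : (Ideal.Quotient.mkₐ R (aug Unit n R ^ k)).comp (subst (fun _ => f.poly)) =
        Ideal.Quotient.mkₐ R (aug Unit n R ^ k) := by
      apply algHom_ext
      rintro ⟨⟩
      rw [AlgHom.comp_apply, subst_T]
      exact (Ideal.Quotient.eq).2 hf
    exact (Ideal.Quotient.eq).1 (DFunLike.congr_fun this (g.poly : TruncPoly Unit n R))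
  have h := subst_mem_aug_pow (fun _ => g'.poly) k h1
  have h2 : subst (fun _ => g'.poly) (g.poly : TruncPoly Unit n R) = (T () : aug Unit n R) :=
    congrArg (fun x : TruncEnd n R => (x.poly : TruncPoly Unit n R)) hg
  rw [map_sub, h2] at h
  exact h

lemma IsCloseToId.map {k : ℕ} {f : TruncEnd n R} (hf : IsCloseToId k f) (φ : R →+* S) :
    IsCloseToId k (TruncEnd.map φ f) := by
  have h := map_mem_aug_pow φ k hf
  rw [map_sub, map_T] at h
  exact h

end

end TruncEnd

namespace BudLaw

open TruncPoly

section

variable {n : ℕ} {R S : Type*} [CommRing R] [CommRing S]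

/-- The `n`-bud law obtained by applying a ring homomorphism to the coefficients. -/
def map (φ : R →+* S) (F : BudLaw n R) : BudLaw n S where
  law := mapAug φ F.law
  right_id := by
    have h := congrArg (mapAug φ) F.right_id
    apply Subtype.ext
    have h := congrArg Subtype.val h
    simp only [coe_mapAug, coe_substAug, map_subst, map_T] at h ⊢
    rw [← h]
    congr 2
    funext s
    fin_cases s <;> apply Subtype.ext <;> simp
  left_id := by
    have h := congrArg (mapAug φ) F.left_id
    apply Subtype.ext
    have h := congrArg Subtype.val h
    simp only [coe_mapAug, coe_substAug, map_subst, map_T] at h ⊢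
    rw [← h]
    congr 2
    funext s
    fin_cases s <;> apply Subtype.ext <;> simp
  assoc := by
    have key : ∀ a b : aug (Fin 3) n R, substAug ![mapAug φ a, mapAug φ b] (mapAug φ F.law) =
        mapAug φ (substAug ![a, b] F.law) := by
      intro a b
      apply Subtype.ext
      simp only [coe_mapAug, coe_substAug, map_subst]
      congr 2
      funext s
      fin_cases s <;> rfl
    have hT : ∀ s : Fin 3, (T s : aug (Fin 3) n S) = mapAug φ (T s) :=
      fun s => Subtype.ext (map_T φ s).symm
    simp only [hT, key, F.assoc]
  comm := by
    have h := congrArg (mapAug φ) F.comm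
    apply Subtype.ext
    have h := congrArg Subtype.val h
    simp only [coe_mapAug, coe_substAug, map_subst] at h ⊢
    rw [← h]
    congr 2
    funext s
    fin_cases s <;> apply Subtype.ext <;> simp

/-- The monoid of endomorphisms of the bud law `F` under composition: the truncated polynomials
`f(T)` with zero constant term such that `f(F(T₀, T₁)) = F(f(T₀), f(T₁))`. -/
def End (F : BudLaw n R) : Submonoid (TruncEnd n R) where
  carrier := {f | substAug (fun _ => F.law) f.poly =
    substAug (fun s => substAug (fun _ => T s) f.poly) F.law}
  one_mem' := by
    apply Subtype.ext
    simp only [TruncEnd.one_poly, coe_substAug, subst_T]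
    have : (fun s : Fin 2 => substAug (fun _ : Unit => (T s : aug (Fin 2) n R)) (T ())) = T :=
      funext fun s => Subtype.ext (subst_T _ _)
    rw [this, subst_self]
  mul_mem' := by
    intro _ g hf hg
    have hf' := congrArg Subtype.val hf
    apply Subtype.ext
    simp only [TruncEnd.mul_poly, coe_substAug, subst_subst] at hf' ⊢
    have hg' : substAug (fun _ => F.law) g.poly =
      substAug (fun s => substAug (fun _ => T s) g.poly) F.law := hg
    rw [hg']
    have h := congrArg (subst (fun s : Fin 2 => substAug (fun _ => T s) g.poly)) hf'
    simp only [subst_subst] at h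
    rw [h]
    congr 2
    funext s
    apply Subtype.ext
    simp only [coe_substAug, subst_subst]
    congr 2
    funext _
    apply Subtype.ext
    simp

/-- The group of automorphisms of the bud law `F` under composition. -/
abbrev Aut (F : BudLaw n R) : Type _ := (F.End)ˣ

/-- The truncated polynomial `f(T)` underlying an automorphism. -/
abbrev Aut.toTruncEnd {F : BudLaw n R} (f : F.Aut) : TruncEnd n R := ((f : F.End) : TruncEnd n R)

/-- The `i`-th step `A_i` of the filtration of the automorphism group of `F` by order of contact
with the identity: the automorphisms `f ≡ T` modulo `(T)^(i+1)`, that is, those of the form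
`T + a_{i+1} T^{i+1} + ⋯ + a_n T^n` if `i ≥ 1`, and all automorphisms if `i = 0`. -/
def autFiltration (F : BudLaw n R) (i : ℕ) : Subgroup F.Aut where
  carrier := {f | f.toTruncEnd.IsCloseToId (i + 1)}
  one_mem' := by
    change TruncEnd.IsCloseToId (i + 1) 1
    exact TruncEnd.IsCloseToId.one _
  mul_mem' {f g} hf hg := by
    have hf : f.toTruncEnd.IsCloseToId (i + 1) := hf
    have hg : g.toTruncEnd.IsCloseToId (i + 1) := hg
    change TruncEnd.IsCloseToId (i + 1) (f.toTruncEnd * g.toTruncEnd)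
    exact hf.mul hg
  inv_mem' {f} hf := by
    have hf : f.toTruncEnd.IsCloseToId (i + 1) := hf
    change TruncEnd.IsCloseToId (i + 1) (f⁻¹).toTruncEnd
    refine hf.of_mul_eq_one ?_
    rw [← Submonoid.coe_mul, Units.mul_inv, Submonoid.coe_one]

lemma mem_autFiltration {F : BudLaw n R} {i : ℕ} {f : F.Aut} :
    f ∈ F.autFiltration i ↔ f.toTruncEnd.IsCloseToId (i + 1) := Iff.rfl

instance (F : BudLaw n R) (i : ℕ) : (F.autFiltration i).Normal where
  conj_mem f hf g := by
    rw [mem_autFiltration] at hf ⊢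
    refine TruncEnd.IsCloseToId.conj (g := g.toTruncEnd) (g' := (g⁻¹).toTruncEnd) hf ?_
    rw [← Submonoid.coe_mul, Units.mul_inv, Submonoid.coe_one]

lemma map_mem_End (φ : R →+* S) {F : BudLaw n R} {G : BudLaw n S} (h : F.map φ = G)
    {f : TruncEnd n R} (hf : f ∈ F.End) : TruncEnd.map φ f ∈ G.End := by
  subst h
  have hf : substAug (fun _ => F.law) f.poly =
    substAug (fun s => substAug (fun _ => T s) f.poly) F.law := hf
  have hf' := congrArg (fun x => TruncPoly.map φ x.1) hf
  simp only [coe_substAug, map_subst] at hf'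
  apply Subtype.ext
  refine hf'.trans ?_
  change subst _ _ = subst _ _
  congr 2
  funext s
  apply Subtype.ext
  simp only [coe_mapAug, coe_substAug, map_subst, TruncEnd.map_poly]
  congr 2
  funext _
  apply Subtype.ext
  simp

/-- Base change of endomorphisms along `φ`. -/
def endMap (φ : R →+* S) {F : BudLaw n R} {G : BudLaw n S} (h : F.map φ = G) :
    F.End →* G.End where
  toFun f := ⟨TruncEnd.map φ f, map_mem_End φ h f.2⟩
  map_one' := Subtype.ext (map_one (TruncEnd.map φ))
  map_mul' f g := Subtype.ext (map_mul (TruncEnd.map φ) (f : TruncEnd n R) (g : TruncEnd n R))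

/-- Base change of automorphisms along `φ`. -/
def autMap (φ : R →+* S) {F : BudLaw n R} {G : BudLaw n S} (h : F.map φ = G) :
    F.Aut →* G.Aut :=
  Units.map (endMap φ h)

lemma autMap_toTruncEnd (φ : R →+* S) {F : BudLaw n R} {G : BudLaw n S}
    (h : F.map φ = G) (f : F.Aut) :
    (autMap φ h f).toTruncEnd = TruncEnd.map φ f.toTruncEnd := rfl

lemma autMap_mem (φ : R →+* S) {F : BudLaw n R} {G : BudLaw n S}
    (h : F.map φ = G) (i : ℕ) {f : F.Aut} (hf : f ∈ F.autFiltration i) :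
    autMap φ h f ∈ G.autFiltration i := by
  rw [mem_autFiltration] at hf ⊢
  exact hf.map φ

lemma aut_ext {F : BudLaw n R} {f g : F.Aut}
    (h : (f.toTruncEnd.poly : TruncPoly Unit n R) = g.toTruncEnd.poly) : f = g :=
  Units.ext (Subtype.ext (TruncEnd.ext_coe h))

lemma map_algebraMap {k : Type*} [CommRing k] [Algebra k R] [Algebra k S] (F : BudLaw n k)
    (φ : R →ₐ[k] S) :
    (F.map (algebraMap k R)).map (φ : R →+* S) = F.map (algebraMap k S) := by
  apply BudLaw.ext
  apply Subtype.ext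
  change TruncPoly.map _ (TruncPoly.map _ _) = TruncPoly.map _ _
  rw [map_map, AlgHom.comp_algebraMap]

/-- Base change of the `i`-th filtration step along a homomorphism of `k`-algebras. -/
def filtMap {k : Type*} [CommRing k] [Algebra k R] [Algebra k S] (F : BudLaw n k)
    (φ : R →ₐ[k] S) (i : ℕ) :
    (F.map (algebraMap k R)).autFiltration i →* (F.map (algebraMap k S)).autFiltration i where
  toFun f := ⟨autMap (φ : R →+* S) (F.map_algebraMap φ) f, autMap_mem _ _ i f.2⟩
  map_one' := Subtype.ext (map_one (autMap (φ : R →+* S) (F.map_algebraMap φ)))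
  map_mul' f g := Subtype.ext (map_mul (autMap (φ : R →+* S) (F.map_algebraMap φ))
    (f : (F.map (algebraMap k R)).Aut) (g : (F.map (algebraMap k R)).Aut))

lemma filtMap_id {k : Type*} [CommRing k] [Algebra k R] (F : BudLaw n k) (i : ℕ) :
    F.filtMap (AlgHom.id k R) i = MonoidHom.id _ := by
  ext1 f
  exact Subtype.ext (aut_ext (TruncPoly.map_id _))

lemma filtMap_comp {k A : Type*} [CommRing k] [CommRing A] [Algebra k R] [Algebra k S]
    [Algebra k A] (F : BudLaw n k) (φ : R →ₐ[k] S) (ψ : S →ₐ[k] A) (i : ℕ) :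
    F.filtMap (ψ.comp φ) i = (F.filtMap ψ i).comp (F.filtMap φ i) := by
  ext1 f
  exact Subtype.ext (aut_ext (TruncPoly.map_map (φ : R →+* S) (ψ : S →+* A) _).symm)

/-- The successive quotient `A_i / A_{i+1}`. -/
abbrev Gr (F : BudLaw n R) (i : ℕ) : Type _ :=
  F.autFiltration i ⧸ (F.autFiltration (i + 1)).subgroupOf (F.autFiltration i)

/-- Base change of `A_i / A_{i+1}` along a homomorphism of `k`-algebras. -/
def grMap {k : Type*} [CommRing k] [Algebra k R] [Algebra k S] (F : BudLaw n k)
    (φ : R →ₐ[k] S) (i : ℕ) :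
    (F.map (algebraMap k R)).Gr i →* (F.map (algebraMap k S)).Gr i :=
  QuotientGroup.map _ _ (F.filtMap φ i) (by
    intro f hf
    rw [Subgroup.mem_comap, Subgroup.mem_subgroupOf]
    rw [Subgroup.mem_subgroupOf] at hf
    exact autMap_mem (φ : R →+* S) (F.map_algebraMap φ) (i + 1) hf)

lemma grMap_mk {k : Type*} [CommRing k] [Algebra k R] [Algebra k S] (F : BudLaw n k)
    (φ : R →ₐ[k] S) (i : ℕ) (f : (F.map (algebraMap k R)).autFiltration i) :
    F.grMap φ i (QuotientGroup.mk f) = QuotientGroup.mk (F.filtMap φ i f) := rfl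

end

section

variable {n : ℕ} {k : Type} [CommRing k]

/-- The `i`-th filtration step as a functor on `k`-algebras, `A ↦ A_i(F_A)`, where `F_A` is the
bud law `F` regarded as defined over `A`. -/
def filtFunctor (F : BudLaw n k) (i : ℕ) : CommAlgCat.{u} k ⥤ GrpCat.{u} where
  obj A := GrpCat.of ((F.map (algebraMap k A)).autFiltration i)
  map φ := GrpCat.ofHom (F.filtMap φ.hom i)
  map_id A := GrpCat.hom_ext (F.filtMap_id i)
  map_comp φ ψ := GrpCat.hom_ext (F.filtMap_comp φ.hom ψ.hom i)

/-- The successive quotient `A_i / A_{i+1}` as a functor on `k`-algebras,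
`A ↦ A_i(F_A) / A_{i+1}(F_A)`. -/
def grFunctor (F : BudLaw n k) (i : ℕ) : CommAlgCat.{u} k ⥤ GrpCat.{u} where
  obj A := GrpCat.of ((F.map (algebraMap k A)).Gr i)
  map φ := GrpCat.ofHom (F.grMap φ.hom i)
  map_id A := by
    apply GrpCat.hom_ext
    apply MonoidHom.ext
    intro x
    obtain ⟨f, rfl⟩ := QuotientGroup.mk_surjective x
    exact congrArg QuotientGroup.mk (DFunLike.congr_fun (F.filtMap_id i) f)
  map_comp φ ψ := by
    apply GrpCat.hom_ext
    apply MonoidHom.ext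
    intro x
    obtain ⟨f, rfl⟩ := QuotientGroup.mk_surjective x
    exact congrArg QuotientGroup.mk (DFunLike.congr_fun (F.filtMap_comp φ.hom ψ.hom i) f)

/-- The quotient map `A_i ⟶ A_i / A_{i+1}`. -/
def grProj (F : BudLaw n k) (i : ℕ) : filtFunctor.{u} F i ⟶ grFunctor.{u} F i where
  app _ := GrpCat.ofHom (QuotientGroup.mk' _)
  naturality _ _ _ := rfl

/-- The coefficient `a_{i+1}` of `T^(i+1)` in an element `f(T)` of `A_i`. -/
def filtCoeff (F : BudLaw n k) (i : ℕ) (A : CommAlgCat.{u} k) (f : (F.filtFunctor i).obj A) : A :=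
  Aut.toTruncEnd (f : (F.map (algebraMap k A)).autFiltration i).1 |>.coeff (i + 1)

end

end BudLaw

namespace FormalGroup

section

variable {R : Type*} [CommRing R]

/-- The series `[m]_F(T)`, given by `[0]_F = 0` and `[m+1]_F(T) = F([m]_F(T), T)`. -/
def mulSeries (F : FormalGroup R) (m : ℕ) : PowerSeries R :=
  (m • (show F.Point Unit from ⟨PowerSeries.X, PowerSeries.HasSubst.X'⟩)).val

lemma mulSeries_zero (F : FormalGroup R) : F.mulSeries 0 = 0 := by
  rw [mulSeries, zero_nsmul]
  rfl

lemma mulSeries_succ (F : FormalGroup R) (m : ℕ) :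
    F.mulSeries (m + 1) = F.toPowerSeries.subst ![F.mulSeries m, PowerSeries.X] := by
  rw [mulSeries, succ_nsmul]
  rfl

open TruncPoly in
/-- The `n`-bud law `F^(n)` obtained from a commutative formal group law `F` by discarding the
terms of degree `≥ n + 1`. -/
def truncation (F : FormalGroup R) [F.IsComm] (n : ℕ) : BudLaw n R where
  law := ⟨ofPowerSeries n F.toPowerSeries, ofPowerSeries_mem_aug F.zero_constantCoeff⟩
  right_id := by
    have h := congrArg (ofPowerSeries n) (F.add_zero (PowerSeries.HasSubst.X' (R := R)))
    exact Subtype.ext ((ofPowerSeries_subst_pair _ _ _ _ _ (ofPowerSeries_X ())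
      ofPowerSeries_zero).symm.trans (h.trans (ofPowerSeries_X ())))
  left_id := by
    have h := congrArg (ofPowerSeries n) (F.zero_add (PowerSeries.HasSubst.X' (R := R)))
    exact Subtype.ext ((ofPowerSeries_subst_pair _ _ _ _ _ ofPowerSeries_zero
      (ofPowerSeries_X ())).symm.trans (h.trans (ofPowerSeries_X ())))
  assoc := by
    have h := congrArg (ofPowerSeries n) F.assoc
    refine Subtype.ext ((ofPowerSeries_subst_pair _ _ _ _ _ ?_ (ofPowerSeries_X 2)).symm.trans
      (h.trans (ofPowerSeries_subst_pair _ _ _ _ _ (ofPowerSeries_X 0) ?_)))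
    · exact ofPowerSeries_subst_pair _ _ _ _ _ (ofPowerSeries_X 0) (ofPowerSeries_X 1)
    · exact ofPowerSeries_subst_pair _ _ _ _ _ (ofPowerSeries_X 1) (ofPowerSeries_X 2)
  comm := by
    have h : F.toPowerSeries = F.toPowerSeries.subst ![MvPowerSeries.X 1, MvPowerSeries.X 0] :=
      FormalGroup.IsComm.comm
    have h := congrArg (ofPowerSeries n) h
    exact Subtype.ext ((ofPowerSeries_subst_pair _ _ _ _ _ (ofPowerSeries_X 1)
      (ofPowerSeries_X 0)).symm.trans h.symm)

end

end FormalGroup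

section Targets

variable (p h : ℕ)

/-- `μ_{p^h - 1}` as a functor on `𝔽_p`-algebras, `A ↦ {a ∈ Aˣ | a^(p^h - 1) = 1}`. -/
def muFunctor : CommAlgCat.{u} (ZMod p) ⥤ GrpCat.{u} where
  obj A := GrpCat.of (rootsOfUnity (p ^ h - 1) A)
  map φ := GrpCat.ofHom (restrictRootsOfUnity φ.hom (p ^ h - 1))
  map_id _ := by
    apply GrpCat.hom_ext
    ext
    rfl
  map_comp _ _ := by
    apply GrpCat.hom_ext
    ext
    rfl

/-- `𝔾_a` as a functor on `𝔽_p`-algebras: the additive group of `A`. -/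
def gaFunctor : CommAlgCat.{u} (ZMod p) ⥤ GrpCat.{u} where
  obj A := GrpCat.of (Multiplicative A)
  map φ := GrpCat.ofHom (AddMonoidHom.toMultiplicative (φ.hom : _ →+ _))

/-- The additive group `{a ∈ A | a^(p^h) = a}` of fixed points of the `p^h`-th power Frobenius of
an `𝔽_p`-algebra `A`. -/
def frobFixed [Fact p.Prime] (A : Type*) [CommRing A] [Algebra (ZMod p) A] : AddSubgroup A where
  carrier := {a | a ^ p ^ h = a}
  zero_mem' := zero_pow (pow_ne_zero _ (Fact.out : p.Prime).ne_zero)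
  add_mem' {a b} ha hb := by
    rcases subsingleton_or_nontrivial A with _ | _
    · exact Subsingleton.elim _ _
    · have := charP_of_injective_algebraMap (algebraMap (ZMod p) A).injective p
      simp only [Set.mem_ofPred_eq] at *
      rw [add_pow_char_pow, ha, hb]
  neg_mem' {a} ha := by
    rcases subsingleton_or_nontrivial A with _ | _
    · exact Subsingleton.elim _ _
    · have := charP_of_injective_algebraMap (algebraMap (ZMod p) A).injective p
      simp only [Set.mem_ofPred_eq] at *
      have h1 := sub_pow_char_pow (p := p) (n := h) (0 : A) a
      rw [zero_pow (pow_ne_zero _ (Fact.out : p.Prime).ne_zero), ha, zero_sub] at h1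
      exact h1

/-- The fixed points `𝔾_a^{Fr_{p^h}}` of the `p^h`-th power Frobenius on `𝔾_a`, as a functor on
`𝔽_p`-algebras. -/
def gaFrobFunctor [Fact p.Prime] : CommAlgCat.{u} (ZMod p) ⥤ GrpCat.{u} where
  obj A := GrpCat.of (Multiplicative (frobFixed p h A))
  map {A B} φ := GrpCat.ofHom (AddMonoidHom.toMultiplicative
    ((((φ.hom : A →+* B) : A →+ B).comp (frobFixed p h A).subtype).codRestrict (frobFixed p h B)
      fun a => by
        have ha : (a : A) ^ p ^ h = a := a.2
        change (φ.hom (a : A)) ^ p ^ h = φ.hom (a : A)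
        rw [← map_pow, ha]))

variable {p h}

/-- The inclusion `μ_{p^h - 1}(A) ⊆ A`. -/
def muVal {A : CommAlgCat.{u} (ZMod p)} (x : (muFunctor p h).obj A) : A :=
  Units.val (Subtype.val (show rootsOfUnity (p ^ h - 1) A from x))

/-- The identification `𝔾_a(A) = A`. -/
def gaVal {A : CommAlgCat.{u} (ZMod p)} (x : (gaFunctor p).obj A) : A :=
  Multiplicative.toAdd (show Multiplicative A from x)

/-- The inclusion `𝔾_a^{Fr_{p^h}}(A) ⊆ A`. -/
def gaFrobVal [Fact p.Prime] {A : CommAlgCat.{u} (ZMod p)} (x : (gaFrobFunctor p h).obj A) : A :=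
  Subtype.val (Multiplicative.toAdd (show Multiplicative (frobFixed p h A) from x))

end Targets

section Schemes

/-- The category of schemes over `Spec 𝔽_p`. -/
abbrev SchOverFp (p : ℕ) : Type (u + 1) :=
  Over (Spec (CommRingCat.of (ULift.{u} (ZMod p))))

/-- The structure map `𝔽_p → Γ(S, 𝒪_S)` of an `𝔽_p`-scheme `S`. -/
def structureHom (p : ℕ) (S : SchOverFp.{u} p) : ZMod p →+* Γ(S.left, ⊤) :=
  ((Scheme.ΓSpecIso (CommRingCat.of (ULift.{u} (ZMod p)))).inv ≫ S.hom.appTop).hom.comp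
    (ULift.ringEquiv.symm : ZMod p ≃+* ULift.{u} (ZMod p)).toRingHom

/-- The functor `S ↦ Γ(S, 𝒪_S)` from `𝔽_p`-schemes to `𝔽_p`-algebras. -/
def globalSections (p : ℕ) : (SchOverFp.{u} p)ᵒᵖ ⥤ CommAlgCat.{u} (ZMod p) where
  obj S := @CommAlgCat.of (ZMod p) _ Γ(S.unop.left, ⊤) _ (structureHom p S.unop).toAlgebra
  map {S S'} f :=
    letI := (structureHom p S.unop).toAlgebra
    letI := (structureHom p S'.unop).toAlgebra
    CommAlgCat.ofHom
      { f.unop.left.appTop.hom with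
        commutes' := fun r => DFunLike.congr_fun (Subsingleton.elim
          (f.unop.left.appTop.hom.comp (structureHom p S.unop)) (structureHom p S'.unop)) r }
  map_id S := by
    let _ := (structureHom p S.unop).toAlgebra
    apply CommAlgCat.hom_ext
    apply AlgHom.ext
    intro x
    change (Scheme.Hom.appTop (𝟙 S.unop.left)).hom x = x
    rw [Scheme.Hom.id_appTop]
    rfl
  map_comp {S S' S''} f g := by
    let _ := (structureHom p S.unop).toAlgebra
    let _ := (structureHom p S''.unop).toAlgebra
    apply CommAlgCat.hom_ext
    apply AlgHom.ext
    intro x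
    change (Scheme.Hom.appTop (g.unop.left ≫ f.unop.left)).hom x = _
    rw [Scheme.Hom.comp_appTop]
    rfl

/-- The presheaf `S ↦ A_i(S)` on `𝔽_p`-schemes attached to an `n`-bud law `F` over `𝔽_p`, where
`A_i(S)` is the `i`-th filtration step of the automorphism group of `F` over `Γ(S, 𝒪_S)`. -/
abbrev autFilt {p n : ℕ} (F : BudLaw n (ZMod p)) (i : ℕ) : (SchOverFp.{u} p)ᵒᵖ ⥤ GrpCat.{u} :=
  globalSections p ⋙ F.filtFunctor i

/-- The presheaf `S ↦ A_i(S) / A_{i+1}(S)` on `𝔽_p`-schemes. -/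
abbrev autGr {p n : ℕ} (F : BudLaw n (ZMod p)) (i : ℕ) : (SchOverFp.{u} p)ᵒᵖ ⥤ GrpCat.{u} :=
  globalSections p ⋙ F.grFunctor i

/-- The class in `A_i(S) / A_{i+1}(S)` of an element of `A_i(S)`. -/
abbrev autGrMk {p n : ℕ} (F : BudLaw n (ZMod p)) (i : ℕ) (S : (SchOverFp.{u} p)ᵒᵖ)
    (f : (autFilt F i).obj S) : (autGr F i).obj S :=
  (F.grProj i).app ((globalSections p).obj S) f

/-- The coefficient of `T^(i+1)` in an element of `A_i(S)`. -/
abbrev autCoeff {p n : ℕ} (F : BudLaw n (ZMod p)) (i : ℕ) (S : (SchOverFp.{u} p)ᵒᵖ)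
    (f : (autFilt F i).obj S) : (globalSections p).obj S :=
  F.filtCoeff i ((globalSections p).obj S) f

end Schemes

end

/-! Write `q = p ^ h`. Everything is read off from the leading coefficient of `f` beyond `T`, over
an arbitrary `𝔽_p`-algebra `A`; the statement for schemes follows by composing with global sections.
Constraints. If `f = T + aT^(i+1) + ⋯` is an automorphism with `i ≥ 1`, the leading part of the
endomorphism equation is `a((X+Y)^(i+1) - X^(i+1) - Y^(i+1)) = 0`. Unless `i+1` is a power of `p`,
some binomial coefficient here is a unit and `a = 0` (`coeff_succ_eq_zero`). Moreover `f` commutes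
with `[p] = T^q`, so `f(T^q) = f(T)^q`, whence `a_i^q = a_i` as long as the degree `q·i` survives
truncation (`coeff_pow_eq_of_defect`). Existence. An endomorphism with given linear term `aT` is
built degree by degree. The leading form of the defect `f(X +_H Y) - (f(X) +_H f(Y))` is a symmetric
additive 2-cocycle (`defect_cocycle`). In characteristic `p` such a form need not be a coboundary,
the exception coming from `((X+Y)^p - X^p - Y^p)/p` and its Frobenius twists; but it is one as soon
as `f` commutes with `[p]` to the next order (`exists_coboundary`, `exists_defect_coboundary`), and
then a correction of `f` by a monomial removes it. Commutation with `T^q` is automatic in two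
situations: when the order considered is at most `q`, or when all coefficients are fixed by the
`q`-power map (`exists_defect_mem_of_height`). Since `H` is defined over `𝔽_p`, `T^(p^j)` is an
endomorphism, and composing with it multiplies orders by `p^j`. Hence `f` need only be an
endomorphism up to order `n / p^j` for `g = f(T^(p^j))` to be an exact one, and `T +_H g` is an
automorphism `T + aT^(p^j) + ⋯` (`exists_aut_coeff_pow`). The bound `n / p^j < q`, that is `n <
p^(j+h)`, separates the case of free `a` from the case `a^q = a`. -/

noncomputable section

/-! ### Symmetric additive 2-cocycles and binomial coefficients modulo `p`. -/

section Cocycle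

variable {p : ℕ} {A : Type*} [CommRing A]

lemma cast_eq_of_modEq (hp : (p : A) = 0) {a b : ℕ} (h : a ≡ b [MOD p]) : (a : A) = b := by
  obtain ⟨c, hc⟩ := Nat.modEq_iff_dvd.1 h
  have h1 : ((b : ℤ) : A) - ((a : ℤ) : A) = (p : A) * (c : A) := by
    rw [← Int.cast_sub, hc]; push_cast; rfl
  rw [hp, zero_mul, sub_eq_zero] at h1
  exact_mod_cast h1.symm

lemma isUnit_cast_of_not_dvd [Fact p.Prime] (hp : (p : A) = 0) {a : ℕ} (h : ¬ p ∣ a) :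
    IsUnit (a : A) := by
  have hc : Nat.Coprime a p := ((Nat.Prime.coprime_iff_not_dvd Fact.out).2 h).symm
  have h1 : IsCoprime ((a : ℤ) : A) ((p : ℤ) : A) :=
    (Nat.isCoprime_iff_coprime.2 hc).map (Int.castRingHom A)
  simp only [Int.cast_natCast, hp] at h1
  exact isCoprime_zero_right.1 h1

lemma natCast_pow_char [Fact p.Prime] (hp : (p : A) = 0) (s : ℕ) : (s : A) ^ p = s := by
  rw [← Nat.cast_pow]
  apply cast_eq_of_modEq hp
  rw [← ZMod.natCast_eq_natCast_iff, Nat.cast_pow, ZMod.pow_card]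

lemma cast_choose_lucas [Fact p.Prime] (hp : (p : A) = 0) (a b : ℕ) :
    (a.choose b : A) = (a % p).choose (b % p) * (a / p).choose (b / p) := by
  rw [← Nat.cast_mul]
  exact cast_eq_of_modEq hp Choose.choose_modEq_choose_mod_mul_choose_div_nat

lemma cast_choose_mul_mul [Fact p.Prime] (hp : (p : A) = 0) (a b : ℕ) :
    ((p * a).choose (p * b) : A) = a.choose b := by
  have h0 : 0 < p := (Fact.out : p.Prime).pos
  rw [cast_choose_lucas hp]
  simp [Nat.mul_div_cancel_left _ h0]

lemma cast_choose_mul_of_not_dvd [Fact p.Prime] (hp : (p : A) = 0) (a : ℕ) {b : ℕ}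
    (hb : ¬ p ∣ b) : ((p * a).choose b : A) = 0 := by
  rw [cast_choose_lucas hp, Nat.mul_mod_right,
    Nat.choose_eq_zero_of_lt (Nat.pos_of_ne_zero fun h => hb (Nat.dvd_of_mod_eq_zero h))]
  simp

/-- Power sums over `𝔽_p` are the weights with which multiplication by `p` sees the coefficients of
a cocycle. In degree `p` only the exponent `p - 1` has nonzero weight, by this lemma and the next
one. -/
lemma sum_range_pow_eq_zero [Fact p.Prime] (hp : (p : A) = 0) {i : ℕ} (hi : i < p - 1) : ∑ s ∈ Finset.range p, (s : A) ^ i = 0 := by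
  have h : ((∑ s ∈ Finset.range p, s ^ i : ℕ) : ZMod p) = 0 := by
    push_cast
    rw [← FiniteField.sum_pow_lt_card_sub_one (ZMod p) i (by rwa [ZMod.card])]
    refine Finset.sum_bij (fun s _ => (s : ZMod p)) (by simp) ?_ ?_ (by simp)
    · intro a ha b hb hab
      rw [ZMod.natCast_eq_natCast_iff] at hab
      exact hab.eq_of_lt_of_lt (Finset.mem_range.1 ha) (Finset.mem_range.1 hb)
    · intro b _
      exact ⟨b.val, Finset.mem_range.2 b.val_lt, ZMod.natCast_zmod_val b⟩
  have h2 := cast_eq_of_modEq (A := A) hp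
    ((ZMod.natCast_eq_natCast_iff _ 0 p).1 (h.trans Nat.cast_zero.symm))
  exact_mod_cast h2

lemma sum_range_pow_pred [Fact p.Prime] (hp : (p : A) = 0) :
    ∑ s ∈ Finset.range p, (s : A) ^ (p - 1) = -1 := by
  have h2 : 2 ≤ p := (Fact.out : p.Prime).two_le
  obtain ⟨q, rfl⟩ : ∃ q, p = q + 1 := ⟨p - 1, by omega⟩
  rw [Finset.sum_range_succ']
  have h1 : ∀ s ∈ Finset.range q, ((s + 1 : ℕ) : A) ^ (q + 1 - 1) = 1 := by
    intro s hs
    have hd : ¬ (q + 1) ∣ s + 1 := fun hd => by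
      have := Nat.le_of_dvd (by omega) hd
      have := Finset.mem_range.1 hs
      omega
    have hu := isUnit_cast_of_not_dvd hp hd
    apply hu.mul_left_cancel
    rw [mul_one, mul_comm, ← pow_succ]
    exact natCast_pow_char hp (s + 1)
  rw [Finset.sum_congr rfl h1]
  have : (q : A) + 1 = 0 := by exact_mod_cast hp
  simp only [Finset.sum_const, Finset.card_range, nsmul_eq_mul, mul_one]
  rw [Nat.cast_zero, zero_pow (by omega), add_zero]
  linear_combination this

/-- A symmetric additive `2`-cocycle `∑ γ_i X^i Y^(m-i)` in characteristic `p` whose associated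
extension is killed by `p` is a coboundary. -/
lemma exists_coboundary [Fact p.Prime] (hp : (p : A) = 0) (m : ℕ) (γ : ℕ → A)
    (hsymm : ∀ i, 0 < i → i < m → γ i = γ (m - i))
    (hcoc : ∀ i j, 0 < i → 0 < j → i + j < m →
      γ (i + j) * (i + j).choose i = γ i * (m - i).choose j)
    (hsum : ∑ i ∈ Finset.Ioo 0 m, γ i * ∑ s ∈ Finset.range p, (s : A) ^ i = 0) :
    ∃ c : A, ∀ i, 0 < i → i < m → γ i = c * m.choose i := by
  have hpp : p.Prime := Fact.out
  have h2 : 2 ≤ p := hpp.two_le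
  induction m using Nat.strong_induction_on generalizing γ with
  | h m ih =>
  -- The cocycle relation for the pair `(1, i - 1)`: the value `γ 1` controls every `γ i` with `i`
  -- prime to `p`.
  have key : ∀ i, 0 < i → i < m → (i : A) * γ i = (m - 1).choose (i - 1) * γ 1 := by
    intro i hi him
    obtain ⟨j, rfl⟩ : ∃ j, i = 1 + j := ⟨i - 1, by omega⟩
    rcases Nat.eq_zero_or_pos j with rfl | hj
    · simp
    · have := hcoc 1 j one_pos hj him
      rw [Nat.choose_one_right] at this
      rw [mul_comm, this, mul_comm, Nat.add_sub_cancel_left]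
  by_cases hdvd : p ∣ m
  · obtain ⟨m', rfl⟩ := hdvd
    -- For `m = p` the sum condition reduces to `-γ (p - 1) = 0`, and symmetry carries this to `γ
    -- 1`; this is what excludes the cocycle `((x+y)^p - x^p - y^p)/p`. For larger multiples of `p`,
    -- `key` at `i = p` gives `0 = (m-1).choose (p-1) * γ 1`, where the binomial coefficient is `1`
    -- by Lucas.
    have h1 : 1 < p * m' → γ 1 = 0 := by
      intro hlt
      rcases (show m' = 1 ∨ 1 < m' by
        rcases Nat.eq_zero_or_pos m' with rfl | h0
        · simp at hlt
        · omega) with rfl | hm'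
      · simp only [mul_one] at hlt hsum hsymm
        rw [Finset.sum_eq_single (p - 1)] at hsum
        · rw [sum_range_pow_pred hp, mul_neg_one, neg_eq_zero] at hsum
          rw [hsymm 1 one_pos hlt, hsum]
        · intro i hi hne
          rw [Finset.mem_Ioo] at hi
          rw [sum_range_pow_eq_zero hp (by omega), mul_zero]
        · intro hn
          exact absurd (Finset.mem_Ioo.2 ⟨by omega, by omega⟩) hn
      · have hpm : p < p * m' := by nlinarith
        have := key p hpp.pos hpm
        rw [hp, zero_mul, cast_choose_lucas hp] at this
        have e1 : (p * m' - 1) % p = p - 1 := by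
          obtain ⟨t, rfl⟩ : ∃ t, m' = t + 1 := ⟨m' - 1, by omega⟩
          rw [mul_add, mul_one, Nat.add_sub_assoc (by omega), Nat.mul_add_mod,
            Nat.mod_eq_of_lt (by omega)]
        rw [e1, Nat.mod_eq_of_lt (show p - 1 < p by omega),
          Nat.div_eq_of_lt (show p - 1 < p by omega)] at this
        simpa using this.symm
    have hz : ∀ i, 0 < i → i < p * m' → ¬ p ∣ i → γ i = 0 := by
      intro i hi him hd
      have := key i hi him
      rw [h1 (by omega), mul_zero] at this
      exact (isUnit_cast_of_not_dvd hp hd).mul_right_eq_zero.1 this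
    rcases Nat.eq_zero_or_pos m' with rfl | hm'
    · exact ⟨0, fun i _ hi => by simp at hi⟩
    -- Only exponents divisible by `p` survive, so the form is a form of degree `m'` in `X^p` and
    -- `Y^p`. Its hypotheses descend because `(p a).choose (p b) = a.choose b` and `s ^ p = s` in
    -- characteristic `p`.
    obtain ⟨c, hc⟩ := ih m' (by nlinarith) (fun i => γ (p * i))
      (by
        intro i hi him
        rw [hsymm _ (by positivity) (by gcongr), Nat.mul_sub])
      (by
        intro i j hi hj hij
        have := hcoc (p * i) (p * j) (by positivity) (by positivity)
          (by rw [← mul_add]; gcongr)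
        rw [← mul_add, ← Nat.mul_sub, cast_choose_mul_mul hp, cast_choose_mul_mul hp] at this
        exact this)
      (by
        rw [← hsum]
        symm
        rw [← Finset.sum_subset (s₁ := (Finset.Ioo 0 m').image (p * ·))]
        · rw [Finset.sum_image (fun a _ b _ hab => Nat.eq_of_mul_eq_mul_left hpp.pos hab)]
          refine Finset.sum_congr rfl fun i _ => ?_
          simp only [pow_mul, natCast_pow_char hp]
        · intro i hi
          obtain ⟨j, hj, rfl⟩ := Finset.mem_image.1 hi
          rw [Finset.mem_Ioo] at hj ⊢
          exact ⟨Nat.mul_pos hpp.pos hj.1, by have := hj.2; gcongr⟩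
        · intro i hi hni
          rw [Finset.mem_Ioo] at hi
          rw [hz i hi.1 hi.2, zero_mul]
          rintro ⟨j, rfl⟩
          exact hni (Finset.mem_image.2 ⟨j, Finset.mem_Ioo.2
            ⟨Nat.pos_of_mul_pos_left hi.1, Nat.lt_of_mul_lt_mul_left hi.2⟩, rfl⟩))
    refine ⟨c, fun i hi him => ?_⟩
    by_cases hd : p ∣ i
    · obtain ⟨j, rfl⟩ := hd
      rw [cast_choose_mul_mul hp]
      exact hc j (Nat.pos_of_mul_pos_left hi) (Nat.lt_of_mul_lt_mul_left him)
    · rw [hz i hi him hd, cast_choose_mul_of_not_dvd hp _ hd, mul_zero]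
  · obtain ⟨u, hu⟩ := (isUnit_cast_of_not_dvd hp hdvd).exists_left_inv
    have main : ∀ i, 0 < i → i < m → ¬ p ∣ i → γ i = u * γ 1 * m.choose i := by
      intro i hi him hd
      apply (isUnit_cast_of_not_dvd hp hd).mul_left_cancel
      rw [key i hi him]
      have h3 : m * (m - 1).choose (i - 1) = m.choose i * i := by
        have := Nat.add_one_mul_choose_eq (m - 1) (i - 1)
        rwa [Nat.sub_add_cancel (by omega), Nat.sub_add_cancel (by omega)] at this
      have h3 : (m : A) * (m - 1).choose (i - 1) = m.choose i * i := by
        rw [← Nat.cast_mul, h3, Nat.cast_mul]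
      linear_combination (-((m - 1).choose (i - 1) : A) * γ 1) * hu + u * γ 1 * h3
    refine ⟨u * γ 1, fun i hi him => ?_⟩
    -- When `p ∣ i`, the complementary index `m - i` is prime to `p`, since `m` is; symmetry reduces
    -- to it.
    by_cases hd : p ∣ i
    · rw [hsymm i hi him, main (m - i) (by omega) (by omega)
        (fun h => hdvd ((Nat.dvd_sub_iff_left him.le hd).1 h)), Nat.choose_symm him.le]
    · exact main i hi him hd

/-- If `m` is not a power of `p`, then some `m.choose i` with `0 < i < m` is prime to `p`. -/
lemma exists_not_dvd_choose [Fact p.Prime] {m : ℕ} (hm : m ≠ 0) (h : ∀ j, m ≠ p ^ j) :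
    ∃ i, 0 < i ∧ i < m ∧ ¬ p ∣ m.choose i := by
  have hpp : p.Prime := Fact.out
  induction m using Nat.strong_induction_on with
  | h m ih =>
  by_cases hd : p ∣ m
  · obtain ⟨a, rfl⟩ := hd
    have ha : a ≠ 0 := by rintro rfl; simp at hm
    obtain ⟨i, hi, hia, hni⟩ := ih a (by
      have := hpp.two_le
      have := Nat.pos_of_ne_zero ha
      nlinarith) ha (fun j hj => h (j + 1) (by rw [hj, pow_succ']))
    refine ⟨p * i, Nat.mul_pos hpp.pos hi, Nat.mul_lt_mul_of_pos_left hia hpp.pos, fun h => hni ?_⟩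
    rw [← ZMod.natCast_eq_zero_iff] at h ⊢
    rwa [cast_choose_mul_mul (by simp)] at h
  · refine ⟨1, one_pos, ?_, by simpa using hd⟩
    have := h 0
    rw [pow_zero] at this
    omega

end Cocycle

/-! ### The order filtration on truncated polynomials and continuity of substitution. -/

namespace TruncPoly

section

variable {σ τ υ : Type*} {n : ℕ} {R S : Type*} [CommRing R] [CommRing S]

lemma aug_pow_eq_map (k : ℕ) :
    aug σ n R ^ k = (MvPolynomial.idealOfVars σ R ^ k).map (mk σ n R) := by
  rw [aug, Ideal.map_pow]

lemma aug_pow_eq_bot {k : ℕ} (hk : n < k) : aug σ n R ^ k = ⊥ :=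
  le_bot_iff.1 (aug_pow (σ := σ) (n := n) (R := R) ▸ Ideal.pow_le_pow_right hk)

lemma aug_pow_le {j k : ℕ} (h : j ≤ k) : aug σ n R ^ k ≤ aug σ n R ^ j :=
  Ideal.pow_le_pow_right h

lemma pow_mem_aug_pow (x : aug σ n R) (k : ℕ) : (x : TruncPoly σ n R) ^ k ∈ aug σ n R ^ k :=
  Ideal.pow_mem_pow x.2 k

lemma mem_aug_pow_iff {k : ℕ} (hk : k ≤ n + 1) (x : TruncPoly σ n R) :
    x ∈ aug σ n R ^ k ↔ ∀ d : σ →₀ ℕ, d.degree < k → coeff d x = 0 := by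
  obtain ⟨q, rfl⟩ := mk_surjective x
  have h1 : mk σ n R q ∈ aug σ n R ^ k ↔ q ∈ MvPolynomial.idealOfVars σ R ^ k := by
    constructor
    · intro h
      rw [aug_pow_eq_map] at h
      obtain ⟨q', hq', he⟩ := (Ideal.mem_map_iff_of_surjective _ mk_surjective).1 h
      have : mk σ n R (q - q') = 0 := by
        rw [map_sub, sub_eq_zero]; exact he.symm
      rw [mk_eq_zero_iff] at this
      have := add_mem (Ideal.pow_le_pow_right hk this) hq'
      rwa [sub_add_cancel] at this
    · intro h
      rw [aug_pow_eq_map]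
      exact Ideal.mem_map_of_mem _ h
  rw [h1, MvPolynomial.mem_pow_idealOfVars_iff']
  refine forall_congr' fun d => imp_congr_right fun hd => ?_
  rw [coeff_mk _ _ (by omega)]

lemma coeff_eq_of_sub_mem {k : ℕ} (hk : k ≤ n + 1) {x y : TruncPoly σ n R}
    (h : x - y ∈ aug σ n R ^ k) {d : σ →₀ ℕ} (hd : d.degree < k) : coeff d x = coeff d y := by
  rw [← sub_eq_zero, ← map_sub]
  exact (mem_aug_pow_iff hk _).1 h d hd

lemma ext_coeff {x y : TruncPoly σ n R}
    (h : ∀ d : σ →₀ ℕ, d.degree ≤ n → coeff d x = coeff d y) : x = y := by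
  rw [← sub_eq_zero, ← Ideal.mem_bot, ← aug_pow, mem_aug_pow_iff le_rfl]
  intro d hd
  rw [map_sub, h d (by omega), sub_self]

/-! ### Continuity of substitution -/

lemma subst_sub_subst_mem {g g' : σ → aug τ n R} {J : Ideal (TruncPoly τ n R)}
    (h : ∀ s, (g s : TruncPoly τ n R) - g' s ∈ J) (a : TruncPoly σ n R) :
    subst g a - subst g' a ∈ J := by
  have : (Ideal.Quotient.mkₐ R J).comp (subst g) = (Ideal.Quotient.mkₐ R J).comp (subst g') := by
    apply algHom_ext
    intro s
    rw [AlgHom.comp_apply, AlgHom.comp_apply, subst_T, subst_T]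
    exact Ideal.Quotient.eq.2 (h s)
  exact Ideal.Quotient.eq.1 (DFunLike.congr_fun this a)

/-- A derivative lowers the order by only one: perturbing the arguments at order `k + 1` moves a
series of order `m` by terms of order `m - 1 + k + 1`. The induction on `m` is the product rule. All
later leading-term computations rest on this estimate. -/
lemma subst_sub_subst_mem_aug_pow {g g' : σ → aug τ n R} {k : ℕ}
    (h : ∀ s, (g s : TruncPoly τ n R) - g' s ∈ aug τ n R ^ (k + 1)) {m : ℕ}
    {a : TruncPoly σ n R} (ha : a ∈ aug σ n R ^ m) :
    subst g a - subst g' a ∈ aug τ n R ^ (m + k) := by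
  induction m generalizing a with
  | zero => exact aug_pow_le (by omega) (subst_sub_subst_mem h a)
  | succ m ih =>
    rw [pow_succ] at ha
    refine Submodule.mul_induction_on ha ?_ ?_
    · intro x hx y hy
      have h1 := Ideal.mul_mem_mul (ih hx) (subst_mem_aug_pow g 1 (by rwa [pow_one]))
      have h2 := Ideal.mul_mem_mul (subst_mem_aug_pow g' m hx) (subst_sub_subst_mem h y)
      rw [← pow_add] at h1 h2
      have h3 := add_mem (aug_pow_le (by omega : m + 1 + k ≤ _) h1)
        (aug_pow_le (by omega : m + 1 + k ≤ _) h2)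
      rw [map_mul, map_mul]
      convert h3 using 1
      ring
    · intro x y hx hy
      have := add_mem hx hy
      rw [map_add, map_add]
      convert this using 1
      ring

/-! ### Substituting a pair -/

lemma subst_congr {g g' : σ → aug τ n R} (h : ∀ s, g s = g' s) (a : TruncPoly σ n R) :
    subst g a = subst g' a := by
  rw [funext h]

lemma substAug_congr {g g' : σ → aug τ n R} (h : ∀ s, g s = g' s) (a : aug σ n R) :
    substAug g a = substAug g' a := by
  rw [funext h]

lemma substAug_substAug (g : τ → aug υ n R) (f : σ → aug τ n R) (a : aug σ n R) :
    substAug g (substAug f a) = substAug (fun s => substAug g (f s)) a :=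
  Subtype.ext (subst_subst g f _)

@[simp] lemma substAug_T (g : σ → aug τ n R) (s : σ) : substAug g (T s) = g s :=
  Subtype.ext (subst_T g s)

@[simp] lemma substAug_zero (g : σ → aug τ n R) : substAug g 0 = 0 :=
  Subtype.ext (map_zero (subst g))

lemma substAug_self (a : aug σ n R) : substAug T a = a := Subtype.ext (subst_self _)

lemma mapAug_substAug (φ : R →+* S) (g : σ → aug τ n R) (a : aug σ n R) :
    mapAug φ (substAug g a) = substAug (fun s => mapAug φ (g s)) (mapAug φ a) :=
  Subtype.ext (map_subst φ g _)

@[simp] lemma mapAug_T (φ : R →+* S) (s : σ) : mapAug φ (T s : aug σ n R) = T s :=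
  Subtype.ext (map_T φ s)

@[simp] lemma mapAug_zero (φ : R →+* S) : mapAug φ (0 : aug σ n R) = 0 :=
  Subtype.ext (map_zero (map φ))

/-- Removing the pure powers of each variable leaves mixed monomials, of degree at least two. With
the identity axioms this yields `F ≡ T₀ + T₁` modulo order `2`. -/
lemma sub_sub_mem_aug_sq {G : TruncPoly (Fin 2) n R} (hG : G ∈ aug (Fin 2) n R) :
    G - subst ![T 0, 0] G - subst ![0, T 1] G ∈ aug (Fin 2) n R ^ 2 := by
  have h0 : ∀ g : Fin 2 → aug (Fin 2) n R, ∀ a : TruncPoly (Fin 2) n R,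
      a - subst g a ∈ aug (Fin 2) n R := by
    intro g a
    have := subst_sub_subst_mem (g := T) (g' := g) (J := aug (Fin 2) n R)
      (fun s => sub_mem (T s).2 (g s).2) a
    rwa [subst_self] at this
  rw [aug, MvPolynomial.idealOfVars, Ideal.map_span] at hG
  refine Submodule.span_induction ?_ (by simp) ?_ ?_ hG
  · rintro _ ⟨_, ⟨s, rfl⟩, rfl⟩
    change ((T s : aug (Fin 2) n R) : TruncPoly (Fin 2) n R) - subst _ (T s : aug (Fin 2) n R).1 -
      subst _ (T s : aug (Fin 2) n R).1 ∈ _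
    rw [subst_T, subst_T]
    fin_cases s <;> simp
  · intro x y _ _ hx hy
    have := add_mem hx hy
    simp only [map_add]
    convert this using 1
    ring
  · intro a x hx' hx
    have hxa : x ∈ aug (Fin 2) n R := by
      rw [aug, MvPolynomial.idealOfVars, Ideal.map_span]; exact hx'
    have hs : ∀ g : Fin 2 → aug (Fin 2) n R, subst g x ∈ aug (Fin 2) n R :=
      fun g => (substAug g ⟨x, hxa⟩).2
    have h1 := Ideal.mul_mem_mul (h0 ![T 0, 0] a) (hs ![T 0, 0])
    have h2 := Ideal.mul_mem_mul (h0 ![0, T 1] a) (hs ![0, T 1])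
    rw [← pow_two] at h1 h2
    have := add_mem (add_mem (Ideal.mul_mem_left _ a hx) h1) h2
    simp only [smul_eq_mul, map_mul]
    convert this using 1
    ring

/-! ### Polynomials in one variable -/

lemma coeff_smul_T_pow (r : R) {i k : ℕ} (hk : k ≤ n) :
    coeff (Finsupp.single () k) (r • ((T () : aug Unit n R) : TruncPoly Unit n R) ^ i) =
      if k = i then r else 0 := by
  rw [coe_T, ← map_pow, ← map_smul, coeff_mk _ _ (by simpa using hk), MvPolynomial.coeff_smul,
    MvPolynomial.coeff_X_pow]
  by_cases h : k = i
  · simp [h]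
  · rw [if_neg h, if_neg, smul_zero]
    intro h'
    exact h (by simpa using (DFunLike.congr_fun h' ()).symm)

lemma eq_sum_coeff (x : TruncPoly Unit n R) :
    x = ∑ i ∈ Finset.range (n + 1),
      coeff (Finsupp.single () i) x • ((T () : aug Unit n R) : TruncPoly Unit n R) ^ i := by
  apply ext_coeff
  intro d hd
  obtain ⟨k, rfl⟩ : ∃ k, d = Finsupp.single () k := ⟨d (), Finsupp.ext fun _ => by simp⟩
  have hd : k ≤ n := by simpa using hd
  rw [map_sum, Finset.sum_congr rfl fun i _ => coeff_smul_T_pow _ hd]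
  rw [Finset.sum_ite_eq, if_pos (Finset.mem_range.2 (by omega))]

lemma sub_smul_T_pow_mem {k : ℕ} (hk : k ≤ n) {x : TruncPoly Unit n R}
    (hx : x ∈ aug Unit n R ^ k) :
    x - coeff (Finsupp.single () k) x • ((T () : aug Unit n R) : TruncPoly Unit n R) ^ k ∈
      aug Unit n R ^ (k + 1) := by
  rw [mem_aug_pow_iff (by omega)]
  intro d hd
  obtain ⟨j, rfl⟩ : ∃ k, d = Finsupp.single () k := ⟨d (), Finsupp.ext fun _ => by simp⟩
  have hd : j < k + 1 := by simpa using hd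
  rw [map_sub, coeff_smul_T_pow _ (by omega)]
  split_ifs with h
  · rw [h, sub_self]
  · rw [(mem_aug_pow_iff (by omega) x).1 hx _ (by simp; omega), sub_zero]

end

end TruncPoly

/-! ### Formal addition of truncated polynomials. -/

namespace BudLaw

open TruncPoly

section

variable {σ τ υ : Type*} {n : ℕ} {R S : Type*} [CommRing R] [CommRing S]

/-- The formal sum of two truncated polynomials with zero constant term. -/
def add (F : BudLaw n R) (x y : aug σ n R) : aug σ n R := substAug ![x, y] F.law

variable (F : BudLaw n R)

lemma substAug_add (g : σ → aug τ n R) (x y : aug σ n R) :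
    substAug g (F.add x y) = F.add (substAug g x) (substAug g y) := by
  rw [add, substAug_substAug]
  exact substAug_congr (fun s => by fin_cases s <;> rfl) _

lemma mapAug_add (φ : R →+* S) (x y : aug σ n R) :
    mapAug φ (F.add x y) = (F.map φ).add (mapAug φ x) (mapAug φ y) := by
  rw [add, mapAug_substAug]
  exact substAug_congr (fun s => by fin_cases s <;> rfl) _

lemma add_T : F.add (T 0) (T 1) = F.law := by
  rw [add]
  refine (substAug_congr (fun s => ?_) _).trans (substAug_self _)
  fin_cases s <;> rfl

lemma add_zero (x : aug σ n R) : F.add x 0 = x := by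
  have h := congrArg (substAug fun _ => x) (show F.add (T ()) 0 = T () from F.right_id)
  rwa [substAug_add, substAug_zero, substAug_T] at h

lemma zero_add (x : aug σ n R) : F.add 0 x = x := by
  have h := congrArg (substAug fun _ => x) (show F.add 0 (T ()) = T () from F.left_id)
  rwa [substAug_add, substAug_zero, substAug_T] at h

lemma add_comm (x y : aug σ n R) : F.add x y = F.add y x := by
  have h := congrArg (substAug ![x, y])
    (show F.add (T 1) (T 0) = F.add (T 0) (T 1) from F.comm.trans F.add_T.symm)
  simp only [substAug_add, substAug_T] at h
  exact h.symm

lemma add_assoc (x y z : aug σ n R) : F.add (F.add x y) z = F.add x (F.add y z) := by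
  have h := congrArg (substAug ![x, y, z])
    (show F.add (F.add (T 0) (T 1)) (T (2 : Fin 3)) = F.add (T 0) (F.add (T 1) (T 2)) from F.assoc)
  simp only [substAug_add, substAug_T] at h
  exact h

lemma add_add_add_comm (x y z w : aug σ n R) :
    F.add (F.add x y) (F.add z w) = F.add (F.add x z) (F.add y w) := by
  rw [F.add_assoc, ← F.add_assoc y, F.add_comm y z, F.add_assoc z, ← F.add_assoc]

lemma law_sub_mem : (F.law : TruncPoly (Fin 2) n R) - (T 0 : aug (Fin 2) n R) -
    (T 1 : aug (Fin 2) n R) ∈ aug (Fin 2) n R ^ 2 := by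
  have h := sub_sub_mem_aug_sq F.law.2
  have h0 : subst ![T 0, 0] (F.law : TruncPoly (Fin 2) n R) =
      ((T 0 : aug (Fin 2) n R) : TruncPoly (Fin 2) n R) :=
    congrArg Subtype.val (F.add_zero (T 0))
  have h1 : subst ![0, T 1] (F.law : TruncPoly (Fin 2) n R) =
      ((T 1 : aug (Fin 2) n R) : TruncPoly (Fin 2) n R) :=
    congrArg Subtype.val (F.zero_add (T 1))
  rwa [h0, h1] at h

/-- The law differs from `T₀ + T₁` by terms of order `2`, so formal addition is linear to first
order in perturbations of its arguments. -/
lemma add_sub_mem {k : ℕ} {x y x' y' : aug σ n R}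
    (hx : (x' : TruncPoly σ n R) - x ∈ aug σ n R ^ (k + 1))
    (hy : (y' : TruncPoly σ n R) - y ∈ aug σ n R ^ (k + 1)) :
    (F.add x' y' : TruncPoly σ n R) - F.add x y - (x' - x) - (y' - y) ∈ aug σ n R ^ (k + 2) := by
  have h := subst_sub_subst_mem_aug_pow (g := ![x', y']) (g' := ![x, y]) (k := k)
    (fun s => by fin_cases s <;> assumption) F.law_sub_mem
  simp only [map_sub, subst_T] at h
  have e : ∀ a b : aug σ n R, (F.add a b : TruncPoly σ n R) =
    subst ![a, b] (F.law : TruncPoly (Fin 2) n R) := fun _ _ => rfl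
  rw [e, e]
  rw [Nat.add_comm k 2]
  convert h using 1
  simp
  ring

lemma add_sub_add_mem (x y : aug σ n R) :
    (F.add x y : TruncPoly σ n R) - (x + y) ∈ aug σ n R ^ 2 := by
  have h := F.add_sub_mem (k := 0) (x := 0) (y := 0) (x' := x) (y' := y)
    (by simp) (by simp)
  rw [F.add_zero] at h
  simpa [sub_sub] using h

lemma mem_End_iff {f : TruncEnd n R} : f ∈ F.End ↔
    substAug (fun _ => F.law) f.poly =
      F.add (substAug (fun _ => T 0) f.poly) (substAug (fun _ => T 1) f.poly) := by
  refine Eq.congr_right (substAug_congr (fun s => ?_) _)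
  fin_cases s <;> rfl

end

end BudLaw

/-! ### Composition in one variable, binary forms and their coefficients. -/

namespace TruncPoly

section

variable {σ τ υ : Type*} {n : ℕ} {R S : Type*} [CommRing R] [CommRing S]

/-- Composition `f(x)` of a truncated polynomial `f` in one variable with `x`. -/
def comp (f : aug Unit n R) (x : aug σ n R) : aug σ n R := substAug (fun _ => x) f

lemma coe_comp (f : aug Unit n R) (x : aug σ n R) :
    (comp f x : TruncPoly σ n R) = subst (fun _ => x) (f : TruncPoly Unit n R) := rfl

lemma substAug_comp (g : σ → aug τ n R) (f : aug Unit n R) (x : aug σ n R) :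
    substAug g (comp f x) = comp f (substAug g x) :=
  substAug_substAug _ _ _

lemma comp_comp (f g : aug Unit n R) (x : aug σ n R) : comp (comp f g) x = comp f (comp g x) :=
  substAug_comp _ f g

lemma mapAug_comp (φ : R →+* S) (f : aug Unit n R) (x : aug σ n R) :
    mapAug φ (comp f x) = comp (mapAug φ f) (mapAug φ x) :=
  mapAug_substAug _ _ _

@[simp] lemma comp_zero (f : aug Unit n R) : comp f (0 : aug σ n R) = 0 := by
  have h : (aug Unit n R).map (subst fun _ => (0 : aug σ n R)) ≤ ⊥ := by
    change ((MvPolynomial.idealOfVars Unit R).map (mk Unit n R)).map _ ≤ _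
    rw [Ideal.map_span, Ideal.map_span, Ideal.span_le]
    rintro _ ⟨_, ⟨_, ⟨s, rfl⟩, rfl⟩, rfl⟩
    simp
  exact Subtype.ext (h (Ideal.mem_map_of_mem _ f.2))

@[simp] lemma T_comp (x : aug σ n R) : comp (T ()) x = x := substAug_T _ _

@[simp] lemma comp_T (f : aug Unit n R) : comp f (T ()) = f := substAug_self f

/-- The binary form `∑ γ_i x^i y^(m-i)`. -/
def binForm {B : Type*} [CommRing B] [Algebra R B] (γ : ℕ → R) (m : ℕ) (x y : B) : B :=
  ∑ i ∈ Finset.range (m + 1), γ i • (x ^ i * y ^ (m - i))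

lemma subst_binForm (g : σ → aug τ n R) (γ : ℕ → R) (m : ℕ) (x y : TruncPoly σ n R) :
    subst g (binForm γ m x y) = binForm γ m (subst g x) (subst g y) := by
  simp [binForm]

lemma binForm_smul {B : Type*} [CommRing B] [Algebra R B] (γ : ℕ → R) (m : ℕ) (r : R) (x : B) :
    binForm γ m (r • x) x = (∑ i ∈ Finset.range (m + 1), γ i * r ^ i) • x ^ m := by
  rw [binForm, Finset.sum_smul]
  refine Finset.sum_congr rfl fun i hi => ?_
  rw [smul_pow, smul_mul_assoc, ← pow_add, Nat.add_sub_cancel' (by simpa [Nat.lt_succ_iff] using hi),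
    smul_smul]

lemma coeff_smul_T_mul_T (r : R) {a b i j : ℕ} (hd : i + j ≤ n) :
    coeff (Finsupp.single 0 i + Finsupp.single 1 j)
      (r • (((T 0 : aug (Fin 2) n R) : TruncPoly (Fin 2) n R) ^ a *
        ((T 1 : aug (Fin 2) n R) : TruncPoly (Fin 2) n R) ^ b)) =
      if a = i ∧ b = j then r else 0 := by
  rw [coe_T, coe_T, ← map_pow, ← map_pow, ← map_mul, ← map_smul, coeff_mk _ _ (by simpa using hd),
    MvPolynomial.X_pow_eq_monomial, MvPolynomial.X_pow_eq_monomial, MvPolynomial.monomial_mul,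
    MvPolynomial.smul_monomial, MvPolynomial.coeff_monomial]
  simp only [mul_one, smul_eq_mul]
  refine if_congr ⟨fun h => ?_, fun h => by rw [h.1, h.2]⟩ rfl rfl
  have h0 := DFunLike.congr_fun h 0
  have h1 := DFunLike.congr_fun h 1
  simpa using And.intro h0 h1

lemma coeff_smul_T_mul_T_mul_T (r : R) {a b c i j k : ℕ} (hd : i + j + k ≤ n) :
    coeff (Finsupp.single 0 i + Finsupp.single 1 j + Finsupp.single 2 k)
      (r • (((T 0 : aug (Fin 3) n R) : TruncPoly (Fin 3) n R) ^ a *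
        ((T 1 : aug (Fin 3) n R) : TruncPoly (Fin 3) n R) ^ b *
        ((T 2 : aug (Fin 3) n R) : TruncPoly (Fin 3) n R) ^ c)) =
      if a = i ∧ b = j ∧ c = k then r else 0 := by
  rw [coe_T, coe_T, coe_T, ← map_pow, ← map_pow, ← map_pow, ← map_mul, ← map_mul, ← map_smul,
    coeff_mk _ _ (by simpa using hd),
    MvPolynomial.X_pow_eq_monomial, MvPolynomial.X_pow_eq_monomial,
    MvPolynomial.X_pow_eq_monomial, MvPolynomial.monomial_mul, MvPolynomial.monomial_mul,
    MvPolynomial.smul_monomial, MvPolynomial.coeff_monomial]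
  simp only [mul_one, smul_eq_mul]
  refine if_congr ⟨fun h => ?_, fun h => by rw [h.1, h.2.1, h.2.2]⟩ rfl rfl
  have h0 := DFunLike.congr_fun h 0
  have h1 := DFunLike.congr_fun h 1
  have h2 := DFunLike.congr_fun h 2
  simpa using And.intro h0 (And.intro h1 h2)

lemma coeff_binForm (γ : ℕ → R) {m i j : ℕ} (hd : i + j ≤ n) :
    coeff (Finsupp.single 0 i + Finsupp.single 1 j)
      (binForm γ m ((T 0 : aug (Fin 2) n R) : TruncPoly (Fin 2) n R) (T 1 : aug (Fin 2) n R)) =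
      if i + j = m then γ i else 0 := by
  rw [binForm, map_sum, Finset.sum_congr rfl fun a _ => coeff_smul_T_mul_T _ hd]
  split_ifs with h
  · rw [Finset.sum_eq_single i, if_pos ⟨rfl, by omega⟩]
    · intro a _ ha
      rw [if_neg (fun h => ha h.1)]
    · intro hi
      exact absurd (Finset.mem_range.2 (by omega)) hi
  · refine Finset.sum_eq_zero fun a ha => if_neg fun h' => h ?_
    rw [Finset.mem_range] at ha
    omega

/-- This lemma and the next three give the coefficient of `T₀^i T₁^j T₂^k` in the four terms of the
2-cocycle identity, turning it into the numerical relation required by `exists_coboundary`. -/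
lemma coeff_binForm_add_left (γ : ℕ → R) {m i j k : ℕ} (hm : i + j + k = m) (hn : m ≤ n) :
    coeff (Finsupp.single 0 i + Finsupp.single 1 j + Finsupp.single 2 k)
      (binForm γ m (((T 0 : aug (Fin 3) n R) : TruncPoly (Fin 3) n R) +
        ((T 1 : aug (Fin 3) n R) : TruncPoly (Fin 3) n R))
        (T 2 : aug (Fin 3) n R)) = γ (i + j) * (i + j).choose i := by
  have hd : i + j + k ≤ n := by omega
  have h1 : ∀ a, coeff (Finsupp.single 0 i + Finsupp.single 1 j + Finsupp.single 2 k)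
      (γ a • ((((T 0 : aug (Fin 3) n R) : TruncPoly (Fin 3) n R) +
        ((T 1 : aug (Fin 3) n R) : TruncPoly (Fin 3) n R)) ^ a *
        ((T 2 : aug (Fin 3) n R) : TruncPoly (Fin 3) n R) ^ (m - a))) =
      ∑ t ∈ Finset.range (a + 1),
        if t = i ∧ a - t = j ∧ m - a = k then γ a * a.choose t else 0 := by
    intro a
    rw [add_pow, Finset.sum_mul, Finset.smul_sum, map_sum]
    refine Finset.sum_congr rfl fun t _ => ?_
    rw [← coeff_smul_T_mul_T_mul_T _ hd, mul_smul]
    congr 2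
    rw [← nsmul_eq_mul', smul_mul_assoc, Nat.cast_smul_eq_nsmul]
  rw [binForm, map_sum, Finset.sum_congr rfl fun a _ => h1 a, Finset.sum_eq_single (i + j),
    Finset.sum_eq_single i, if_pos ⟨rfl, by omega, by omega⟩]
  · intro t _ ht
    rw [if_neg fun h => ht h.1]
  · intro h
    exact absurd (Finset.mem_range.2 (by omega)) h
  · intro a _ ha
    refine Finset.sum_eq_zero fun t ht => if_neg fun h => ha ?_
    rw [Finset.mem_range] at ht
    omega
  · intro h
    exact absurd (Finset.mem_range.2 (by omega)) h

lemma coeff_binForm_add_right (γ : ℕ → R) {m i j k : ℕ} (hm : i + j + k = m) (hn : m ≤ n) :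
    coeff (Finsupp.single 0 i + Finsupp.single 1 j + Finsupp.single 2 k)
      (binForm γ m ((T 0 : aug (Fin 3) n R) : TruncPoly (Fin 3) n R)
        ((T 1 : aug (Fin 3) n R) + (T 2 : aug (Fin 3) n R))) = γ i * (m - i).choose j := by
  have hd : i + j + k ≤ n := by omega
  have h1 : ∀ a, coeff (Finsupp.single 0 i + Finsupp.single 1 j + Finsupp.single 2 k)
      (γ a • (((T 0 : aug (Fin 3) n R) : TruncPoly (Fin 3) n R) ^ a *
        (((T 1 : aug (Fin 3) n R) : TruncPoly (Fin 3) n R) +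
        ((T 2 : aug (Fin 3) n R) : TruncPoly (Fin 3) n R)) ^ (m - a))) =
      ∑ t ∈ Finset.range (m - a + 1),
        if a = i ∧ t = j ∧ m - a - t = k then γ a * (m - a).choose t else 0 := by
    intro a
    rw [add_pow, Finset.mul_sum, Finset.smul_sum, map_sum]
    refine Finset.sum_congr rfl fun t _ => ?_
    rw [← coeff_smul_T_mul_T_mul_T _ hd, mul_smul]
    congr 2
    rw [← nsmul_eq_mul', mul_smul_comm, Nat.cast_smul_eq_nsmul, mul_assoc]
  rw [binForm, map_sum, Finset.sum_congr rfl fun a _ => h1 a, Finset.sum_eq_single i,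
    Finset.sum_eq_single j, if_pos ⟨rfl, rfl, by omega⟩]
  · intro t _ ht
    rw [if_neg fun h => ht h.2.1]
  · intro h
    exact absurd (Finset.mem_range.2 (by omega)) h
  · intro a _ ha
    exact Finset.sum_eq_zero fun t ht => if_neg fun h => ha h.1
  · intro h
    exact absurd (Finset.mem_range.2 (by omega)) h

lemma coeff_binForm_left (γ : ℕ → R) {m i j k : ℕ} (hk : 0 < k) (hn : i + j + k ≤ n) :
    coeff (Finsupp.single 0 i + Finsupp.single 1 j + Finsupp.single 2 k)
      (binForm γ m ((T 0 : aug (Fin 3) n R) : TruncPoly (Fin 3) n R)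
        (T 1 : aug (Fin 3) n R)) = 0 := by
  rw [binForm, map_sum]
  refine Finset.sum_eq_zero fun a _ => ?_
  have := coeff_smul_T_mul_T_mul_T (γ a) (a := a) (b := m - a) (c := 0) hn
  rw [pow_zero, mul_one] at this
  rw [this, if_neg]
  omega

lemma coeff_binForm_right (γ : ℕ → R) {m i j k : ℕ} (hi : 0 < i) (hn : i + j + k ≤ n) :
    coeff (Finsupp.single 0 i + Finsupp.single 1 j + Finsupp.single 2 k)
      (binForm γ m ((T 1 : aug (Fin 3) n R) : TruncPoly (Fin 3) n R)
        (T 2 : aug (Fin 3) n R)) = 0 := by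
  rw [binForm, map_sum]
  refine Finset.sum_eq_zero fun a _ => ?_
  have := coeff_smul_T_mul_T_mul_T (γ a) (a := 0) (b := a) (c := m - a) hn
  rw [pow_zero, one_mul] at this
  rw [this, if_neg]
  omega

/-- The leading form of an element of `(T₀, T₁)^m`. -/
lemma exists_sub_binForm_mem {m : ℕ} (hm : m ≤ n) {x : TruncPoly (Fin 2) n R}
    (hx : x ∈ aug (Fin 2) n R ^ m) : ∃ γ : ℕ → R,
      x - binForm γ m ((T 0 : aug (Fin 2) n R) : TruncPoly (Fin 2) n R) (T 1 : aug (Fin 2) n R) ∈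
        aug (Fin 2) n R ^ (m + 1) := by
  refine ⟨fun i => coeff (Finsupp.single 0 i + Finsupp.single 1 (m - i)) x, ?_⟩
  rw [mem_aug_pow_iff (by omega)]
  intro d hd
  obtain ⟨i, j, rfl⟩ : ∃ i j, d = Finsupp.single 0 i + Finsupp.single 1 j :=
    ⟨d 0, d 1, by ext s; fin_cases s <;> simp⟩
  simp only [map_add, Finsupp.degree_single] at hd
  rw [map_sub, coeff_binForm _ (by omega)]
  split_ifs with h
  · rw [show m - i = j by omega, sub_self]
  · rw [sub_zero]
    refine (mem_aug_pow_iff (by omega) _).1 hx _ ?_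
    simp only [map_add, Finsupp.degree_single]
    omega

lemma eq_zero_of_binForm_mem (γ : ℕ → R) {m : ℕ} (hm : m ≤ n)
    (h : binForm γ m ((T 0 : aug (Fin 2) n R) : TruncPoly (Fin 2) n R) (T 1 : aug (Fin 2) n R) ∈
      aug (Fin 2) n R ^ (m + 1)) {i : ℕ} (hi : i ≤ m) : γ i = 0 := by
  have := (mem_aug_pow_iff (by omega) _).1 h (Finsupp.single 0 i + Finsupp.single 1 (m - i))
    (by simp only [map_add, Finsupp.degree_single]; omega)
  rwa [coeff_binForm _ (by omega), if_pos (by omega)] at this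

lemma eq_zero_of_smul_T_pow_mem {m : ℕ} (hm : m ≤ n) {r : R}
    (h : r • ((T () : aug Unit n R) : TruncPoly Unit n R) ^ m ∈ aug Unit n R ^ (m + 1)) :
    r = 0 := by
  have := (mem_aug_pow_iff (by omega) _).1 h (Finsupp.single () m)
    (by simp only [Finsupp.degree_single]; omega)
  rwa [coeff_smul_T_pow _ hm, if_pos rfl] at this

lemma binForm_eq_of_choose {B : Type*} [CommRing B] [Algebra R B] {γ : ℕ → R} {m : ℕ} {c : R}
    (hm : 0 < m) (h0 : γ 0 = 0) (h1 : γ m = 0) (h : ∀ i, 0 < i → i < m → γ i = c * m.choose i)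
    (x y : B) : binForm γ m x y = c • ((x + y) ^ m - x ^ m - y ^ m) := by
  obtain ⟨k, rfl⟩ : ∃ k, m = k + 1 := ⟨m - 1, by omega⟩
  have e : ∀ i ∈ Finset.range k, γ (i + 1) • (x ^ (i + 1) * y ^ (k + 1 - (i + 1))) =
      c • (x ^ (i + 1) * y ^ (k + 1 - (i + 1)) * ((k + 1).choose (i + 1) : B)) := by
    intro i hi
    rw [h _ (by omega) (by simpa using hi), mul_smul]
    congr 1
    rw [← nsmul_eq_mul', Nat.cast_smul_eq_nsmul]
  rw [binForm, add_pow, Finset.sum_range_succ, Finset.sum_range_succ', Finset.sum_range_succ,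
    Finset.sum_range_succ', h0, h1, Finset.sum_congr rfl e, ← Finset.smul_sum]
  simp

end

end TruncPoly

/-! ### The defect of a truncated polynomial and the removal of its leading form. -/

namespace BudLaw

open TruncPoly

section

variable {σ τ υ : Type*} {n : ℕ} {R S : Type*} [CommRing R] [CommRing S] (F : BudLaw n R)

/-- The formal multiple `[m]_F(x)`. -/
def nsum (x : aug σ n R) : ℕ → aug σ n R
  | 0 => 0
  | m + 1 => F.add (nsum x m) x

lemma substAug_nsum (g : σ → aug τ n R) (x : aug σ n R) (m : ℕ) :
    substAug g (F.nsum x m) = F.nsum (substAug g x) m := by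
  induction m with
  | zero => exact substAug_zero g
  | succ m ih => rw [nsum, substAug_add, ih, nsum]

lemma mapAug_nsum (φ : R →+* S) (x : aug σ n R) (m : ℕ) :
    mapAug φ (F.nsum x m) = (F.map φ).nsum (mapAug φ x) m := by
  induction m with
  | zero => exact mapAug_zero φ
  | succ m ih => rw [nsum, mapAug_add, ih, nsum]

lemma nsum_sub_mem (x : aug σ n R) (m : ℕ) :
    (F.nsum x m : TruncPoly σ n R) - (m : R) • (x : TruncPoly σ n R) ∈ aug σ n R ^ 2 := by
  induction m with
  | zero => simp [nsum]
  | succ m ih =>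
    have := add_mem ih (F.add_sub_add_mem (F.nsum x m) x)
    rw [nsum]
    convert this using 1
    rw [Nat.cast_succ, add_smul, one_smul]
    ring

/-- The failure of `f` to be an endomorphism of `F`. -/
def defect (f : aug Unit n R) : TruncPoly (Fin 2) n R :=
  (comp f F.law : TruncPoly (Fin 2) n R) - F.add (comp f (T (0 : Fin 2))) (comp f (T 1))

lemma subst_defect (f : aug Unit n R) (x y : aug σ n R) :
    subst ![x, y] (F.defect f) = comp f (F.add x y) - F.add (comp f x) (comp f y) := by
  rw [defect, map_sub, ← coe_substAug, ← coe_substAug, substAug_comp, substAug_add, substAug_comp,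
    substAug_comp, substAug_T, substAug_T]
  rfl

lemma mem_End_iff_defect {f : TruncEnd n R} : f ∈ F.End ↔ F.defect f.poly = 0 := by
  rw [mem_End_iff, defect, sub_eq_zero]
  exact Subtype.ext_iff

/-- The formal and the ordinary sum agree to order `2`, so inside a series of order `m + 1` they are
interchangeable modulo order `m + 2`. -/
lemma subst_defect_add_left {f : aug Unit n R} {m : ℕ}
    (hf : F.defect f ∈ aug (Fin 2) n R ^ (m + 1)) (x y z : aug σ n R) :
    subst ![F.add x y, z] (F.defect f) - subst ![x + y, z] (F.defect f) ∈ aug σ n R ^ (m + 2) := by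
  refine subst_sub_subst_mem_aug_pow (k := 1) (fun s => ?_) hf
  fin_cases s
  · exact F.add_sub_add_mem x y
  · simp

lemma subst_defect_comm (f : aug Unit n R) (x y : aug σ n R) :
    subst ![x, y] (F.defect f) = subst ![y, x] (F.defect f) := by
  rw [subst_defect, subst_defect, F.add_comm x, F.add_comm (comp f x)]

lemma subst_defect_zero_right (f : aug Unit n R) (x : aug σ n R) :
    subst ![x, 0] (F.defect f) = 0 := by
  rw [subst_defect, comp_zero, add_zero, add_zero, sub_self]

/-- The defect is, to leading order, a `2`-cocycle. -/
lemma defect_cocycle {f : aug Unit n R} {m : ℕ}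
    (hf : F.defect f ∈ aug (Fin 2) n R ^ (m + 1)) (x y z : aug σ n R) :
    subst ![x, y] (F.defect f) + subst ![x + y, z] (F.defect f) -
      subst ![y, z] (F.defect f) - subst ![x, y + z] (F.defect f) ∈ aug σ n R ^ (m + 2) := by
  -- Expanding `f` of a triple formal sum by splitting off one summand at a time. Associativity and
  -- commutativity give a second expansion of the same quantity, from `(y, z, x)`; the difference of
  -- the two is the cocycle identity.
  have half : ∀ x y z : aug σ n R, (comp f (F.add (F.add x y) z) : TruncPoly σ n R) -
      F.add (F.add (comp f x) (comp f y)) (comp f z) - subst ![x, y] (F.defect f) -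
      subst ![x + y, z] (F.defect f) ∈ aug σ n R ^ (m + 2) := by
    intro x y z
    have h1 := F.add_sub_mem (k := m) (x := F.add (comp f x) (comp f y)) (y := comp f z)
      (x' := comp f (F.add x y)) (y' := comp f z)
      (by rw [← subst_defect]; exact subst_mem_aug_pow _ _ hf) (by simp)
    have h2 := F.subst_defect_add_left hf x y z
    rw [subst_defect] at h2
    rw [← subst_defect, sub_self, sub_zero] at h1
    convert add_mem h1 h2 using 1
    ring
  have h1 := half x y z
  have h2 := half y z x
  rw [F.add_comm (F.add y z), ← F.add_assoc, F.add_comm _ (comp f x), ← F.add_assoc,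
    F.subst_defect_comm f (y + z)] at h2
  convert sub_mem h2 h1 using 1
  ring

/-- Iterating the defect. -/
lemma comp_nsum_sub_mem {f : aug Unit n R} {m : ℕ}
    (hf : F.defect f ∈ aug (Fin 2) n R ^ (m + 1)) (x : aug σ n R) (s : ℕ) :
    (comp f (F.nsum x s) : TruncPoly σ n R) - F.nsum (comp f x) s -
      ∑ t ∈ Finset.range s, subst ![F.nsum x t, x] (F.defect f) ∈ aug σ n R ^ (m + 2) ∧
    (comp f (F.nsum x s) : TruncPoly σ n R) - F.nsum (comp f x) s ∈ aug σ n R ^ (m + 1) := by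
  induction s with
  | zero => simp [nsum]
  | succ s ih =>
    -- The second half of the induction hypothesis is what allows the formal sum to be linearised
    -- here.
    have h1 := F.add_sub_mem (k := m) (x := F.nsum (comp f x) s) (y := comp f x)
      (x' := comp f (F.nsum x s)) (y' := comp f x) ih.2 (by simp)
    have h2 := F.subst_defect f (F.nsum x s) x
    have h3 : (comp f (F.nsum x (s + 1)) : TruncPoly σ n R) - F.nsum (comp f x) (s + 1) -
      ∑ t ∈ Finset.range (s + 1), subst ![F.nsum x t, x] (F.defect f) ∈ aug σ n R ^ (m + 2) := by
      rw [Finset.sum_range_succ, h2, nsum, nsum]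
      convert add_mem ih.1 h1 using 1
      ring
    refine ⟨h3, ?_⟩
    have h4 : ∑ t ∈ Finset.range (s + 1), subst ![F.nsum x t, x] (F.defect f) ∈
        aug σ n R ^ (m + 1) := sum_mem fun t _ => subst_mem_aug_pow _ _ hf
    convert add_mem (aug_pow_le (by omega) h3) h4 using 1
    ring

variable {p : ℕ} [Fact p.Prime]

/-- Lazard's comparison lemma in characteristic `p`: the leading form of the defect is a
coboundary, provided that `f` commutes with multiplication by `p` to the next order. -/
lemma exists_defect_coboundary (hp : (p : R) = 0) {f : aug Unit n R} {m : ℕ} (hm : m + 1 ≤ n)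
    (hf : F.defect f ∈ aug (Fin 2) n R ^ (m + 1))
    (hfp : (comp f (F.nsum (T ()) p) : TruncPoly Unit n R) - F.nsum f p ∈
      aug Unit n R ^ (m + 2)) :
    ∃ c : R, F.defect f -
      c • ((((T 0 : aug (Fin 2) n R) : TruncPoly (Fin 2) n R) +
        ((T 1 : aug (Fin 2) n R) : TruncPoly (Fin 2) n R)) ^ (m + 1) -
        ((T 0 : aug (Fin 2) n R) : TruncPoly (Fin 2) n R) ^ (m + 1) -
        ((T 1 : aug (Fin 2) n R) : TruncPoly (Fin 2) n R) ^ (m + 1)) ∈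
        aug (Fin 2) n R ^ (m + 2) := by
  obtain ⟨γ, hγ⟩ := exists_sub_binForm_mem hm hf
  have hform3 : ∀ x y : aug (Fin 3) n R, subst ![x, y] (F.defect f) -
      binForm γ (m + 1) (x : TruncPoly (Fin 3) n R) y ∈ aug (Fin 3) n R ^ (m + 2) := by
    intro x y
    have := subst_mem_aug_pow ![x, y] _ hγ
    rwa [map_sub, subst_binForm, subst_T, subst_T] at this
  have hsymm : ∀ i, i ≤ m + 1 → γ i = γ (m + 1 - i) := by
    intro i hi
    have h1 := subst_mem_aug_pow ![T (1 : Fin 2), T 0] _ hγ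
    have h2 := subst_mem_aug_pow ![T (0 : Fin 2), T 1] _ hγ
    rw [map_sub, subst_binForm, subst_T, subst_T] at h1 h2
    rw [subst_defect_comm] at h2
    have h3 := sub_mem h1 h2
    rw [sub_sub_sub_cancel_left] at h3
    refine sub_eq_zero.1 (eq_zero_of_binForm_mem (fun i => γ i - γ (m + 1 - i)) hm ?_ hi)
    convert h3 using 1
    simp only [binForm, sub_smul, Finset.sum_sub_distrib]
    refine congrArg₂ (· - ·) rfl ?_
    refine (Finset.sum_range_reflect _ _).symm.trans ?_
    refine Finset.sum_congr rfl fun j hj => ?_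
    have hj : j < m + 2 := Finset.mem_range.1 hj
    rw [show m + 1 + 1 - 1 - j = m + 1 - j by omega, show m + 1 - (m + 1 - j) = j by omega,
      mul_comm]
    rfl
  -- The defect vanishes when one argument is zero, so its leading form has no pure powers.
  have hlast : γ (m + 1) = 0 := by
    have h1 := subst_mem_aug_pow ![T (), 0] _ hγ
    rw [map_sub, subst_binForm, subst_T, subst_T, subst_defect_zero_right, zero_sub,
      neg_mem_iff] at h1
    refine eq_zero_of_smul_T_pow_mem hm ?_
    convert h1 using 1
    rw [binForm, Finset.sum_eq_single (m + 1)]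
    · simp
    · intro i hi hne
      have : i < m + 2 := Finset.mem_range.1 hi
      simp [show m + 1 - i ≠ 0 by omega]
    · simp
  have hfirst : γ 0 = 0 := by
    rw [hsymm 0 (by omega), Nat.sub_zero, hlast]
  have hcoc : ∀ i j, 0 < i → 0 < j → i + j < m + 1 →
      γ (i + j) * (i + j).choose i = γ i * (m + 1 - i).choose j := by
    intro i j hi hj hij
    have h1 := F.defect_cocycle hf (T (0 : Fin 3)) (T 1) (T 2)
    have h2 := sub_mem h1 (sub_mem (sub_mem (add_mem (hform3 (T 0) (T 1))
      (hform3 (T 0 + T 1) (T 2))) (hform3 (T 1) (T 2))) (hform3 (T 0) (T 1 + T 2)))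
    obtain ⟨k, hk⟩ : ∃ k, i + j + k = m + 1 := ⟨m + 1 - (i + j), by omega⟩
    have h3 : binForm γ (m + 1) ((T 0 : aug (Fin 3) n R) : TruncPoly (Fin 3) n R)
          (T 1 : aug (Fin 3) n R) +
        binForm γ (m + 1) (((T 0 : aug (Fin 3) n R) : TruncPoly (Fin 3) n R) +
          ((T 1 : aug (Fin 3) n R) : TruncPoly (Fin 3) n R)) (T 2 : aug (Fin 3) n R) -
        binForm γ (m + 1) ((T 1 : aug (Fin 3) n R) : TruncPoly (Fin 3) n R)
          (T 2 : aug (Fin 3) n R) -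
        binForm γ (m + 1) ((T 0 : aug (Fin 3) n R) : TruncPoly (Fin 3) n R)
          ((T 1 : aug (Fin 3) n R) + (T 2 : aug (Fin 3) n R)) ∈ aug (Fin 3) n R ^ (m + 2) := by
      convert h2 using 1
      simp only [Submodule.coe_add]
      ring
    have h4 := (mem_aug_pow_iff (by omega) _).1 h3
      (Finsupp.single 0 i + Finsupp.single 1 j + Finsupp.single 2 k)
      (by simp only [map_add, Finsupp.degree_single]; omega)
    rw [map_sub, map_sub, map_add, coeff_binForm_left _ (by omega) (by omega),
      coeff_binForm_right _ (by omega) (by omega), coeff_binForm_add_left _ hk hm,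
      coeff_binForm_add_right _ hk hm] at h4
    linear_combination h4
  -- To leading order, `f([p]T) - [p]f(T)` is the sum over `t < p` of the defect at `([t]T, T)`. As
  -- `[t]T ≡ tT`, that is the sum of the leading form at `(tT, T)`, and it must vanish by the
  -- hypothesis on `[p]`.
  have hsum : ∑ i ∈ Finset.Ioo 0 (m + 1), γ i * ∑ s ∈ Finset.range p, (s : R) ^ i = 0 := by
    have h1 := (F.comp_nsum_sub_mem hf (T ()) p).1
    rw [comp_T] at h1
    have h2 : ∀ t : ℕ, subst ![F.nsum (T ()) t, T ()] (F.defect f) -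
        (∑ i ∈ Finset.range (m + 2), γ i * (t : R) ^ i) •
          ((T () : aug Unit n R) : TruncPoly Unit n R) ^ (m + 1) ∈ aug Unit n R ^ (m + 2) := by
      intro t
      have hx : (t : R) • ((T () : aug Unit n R) : TruncPoly Unit n R) ∈ aug Unit n R :=
        Submodule.smul_of_tower_mem _ _ (T ()).2
      have h3 : subst ![F.nsum (T ()) t, T ()] (F.defect f) -
          subst ![⟨_, hx⟩, T ()] (F.defect f) ∈ aug Unit n R ^ (m + 1 + 1) := by
        refine subst_sub_subst_mem_aug_pow (k := 1) (fun s => ?_) hf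
        fin_cases s
        · exact F.nsum_sub_mem (T ()) t
        · simp
      have h4 := subst_mem_aug_pow ![⟨_, hx⟩, T ()] _ hγ
      rw [map_sub, subst_binForm, subst_T, subst_T] at h4
      have h5 := add_mem h3 h4
      rw [sub_add_sub_cancel] at h5
      rwa [← binForm_smul]
    have h3 := sub_mem (sub_mem hfp h1) (sum_mem fun t (_ : t ∈ Finset.range p) => h2 t)
    rw [sub_sub_cancel, Finset.sum_sub_distrib, sub_sub_cancel, ← Finset.sum_smul] at h3
    have h4 := eq_zero_of_smul_T_pow_mem hm h3
    rw [Finset.sum_comm] at h4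
    rw [← h4]
    refine (Finset.sum_congr rfl fun i _ => Finset.mul_sum _ _ _).trans ?_
    refine Finset.sum_subset ?_ ?_
    · intro i hi
      have := Finset.mem_Ioo.1 hi
      exact Finset.mem_range.2 (by omega)
    · intro i hi hni
      have h5 := Finset.mem_range.1 hi
      rw [Finset.mem_Ioo] at hni
      have : γ i = 0 := by
        rcases Nat.eq_zero_or_pos i with rfl | h6
        · exact hfirst
        · rwa [show i = m + 1 by omega]
      simp [this]
  obtain ⟨c, hc⟩ := exists_coboundary hp (m + 1) γ (fun i _ hi => hsymm i hi.le) hcoc hsum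
  refine ⟨c, ?_⟩
  rwa [← binForm_eq_of_choose (by omega) hfirst hlast hc]

/-- Subtracting `c T^(m+1)` from `f` changes the defect, to leading order, by minus the coboundary
of `c T^(m+1)`, which is exactly the leading form found in `exists_defect_coboundary`. -/
lemma exists_defect_mem_succ (hp : (p : R) = 0) {f : aug Unit n R} {m : ℕ} (hm : m + 1 ≤ n)
    (hf : F.defect f ∈ aug (Fin 2) n R ^ (m + 1))
    (hfp : (comp f (F.nsum (T ()) p) : TruncPoly Unit n R) - F.nsum f p ∈
      aug Unit n R ^ (m + 2)) :
    ∃ g : aug Unit n R, (f : TruncPoly Unit n R) - g ∈ aug Unit n R ^ (m + 1) ∧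
      F.defect g ∈ aug (Fin 2) n R ^ (m + 2) := by
  obtain ⟨c, hc⟩ := F.exists_defect_coboundary hp hm hf hfp
  have hT : ((T () : aug Unit n R) : TruncPoly Unit n R) ^ (m + 1) ∈ aug Unit n R ^ (m + 1) :=
    pow_mem_aug_pow _ _
  have hcT : c • ((T () : aug Unit n R) : TruncPoly Unit n R) ^ (m + 1) ∈
    aug Unit n R ^ (m + 1) := Submodule.smul_of_tower_mem _ _ hT
  refine ⟨⟨f - c • ((T () : aug Unit n R) : TruncPoly Unit n R) ^ (m + 1),
    sub_mem f.2 (Ideal.pow_le_self (by omega) hcT)⟩, by simpa using hcT, ?_⟩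
  set g : aug Unit n R := ⟨f - c • ((T () : aug Unit n R) : TruncPoly Unit n R) ^ (m + 1),
    sub_mem f.2 (Ideal.pow_le_self (by omega) hcT)⟩ with hg
  have hcomp : ∀ x : aug (Fin 2) n R, (comp g x : TruncPoly (Fin 2) n R) =
      comp f x - c • (x : TruncPoly (Fin 2) n R) ^ (m + 1) := by
    intro x
    rw [coe_comp, coe_comp, hg]
    simp only [map_sub, map_smul, map_pow, subst_T]
  have hpow : ∀ x : aug (Fin 2) n R, (comp g x : TruncPoly (Fin 2) n R) - comp f x ∈
      aug (Fin 2) n R ^ (m + 1) := by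
    intro x
    rw [hcomp, sub_sub_cancel_left, neg_mem_iff]
    exact Submodule.smul_of_tower_mem _ _ (pow_mem_aug_pow x _)
  have h1 := F.add_sub_mem (hpow (T 0)) (hpow (T 1))
  have h2 := subst_sub_subst_mem_aug_pow (g := fun _ : Unit => F.law)
    (g' := fun _ => T 0 + T 1) (k := 1)
    (fun _ => by simpa [sub_sub] using F.law_sub_mem) hT
  rw [map_pow, map_pow, subst_T, subst_T] at h2
  have h3 := Submodule.smul_of_tower_mem _ c h2
  have h4 := sub_mem (sub_mem hc h3) h1
  rw [defect] at h4 ⊢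
  convert h4 using 1
  rw [hcomp, hcomp, hcomp, Submodule.coe_add, smul_sub, smul_sub, smul_sub]
  ring

/-- Endomorphisms with prescribed leading coefficient, up to order `M`. -/
lemma exists_defect_mem (hp : (p : R) = 0) {M : ℕ} (hM : M ≤ n)
    (h : ∀ f : aug Unit n R,
      (comp f (F.nsum (T ()) p) : TruncPoly Unit n R) - F.nsum f p ∈ aug Unit n R ^ (M + 1))
    (a : R) : ∃ f : aug Unit n R,
      (f : TruncPoly Unit n R) - a • ((T () : aug Unit n R) : TruncPoly Unit n R) ∈
        aug Unit n R ^ 2 ∧ F.defect f ∈ aug (Fin 2) n R ^ (M + 1) := by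
  induction M with
  | zero =>
    refine ⟨⟨_, Submodule.smul_of_tower_mem _ a (T ()).2⟩, by simp, ?_⟩
    rw [_root_.zero_add, pow_one]
    exact sub_mem (comp _ _).2 (F.add _ _).2
  | succ m ih =>
    obtain ⟨f, hfa, hf⟩ := ih (by omega) fun f => aug_pow_le (by omega) (h f)
    -- At `m = 0` a correction would have degree one and spoil the prescribed linear term. Instead
    -- `aT` itself is used: its defect already has order `2`.
    rcases Nat.eq_zero_or_pos m with rfl | hm
    · refine ⟨⟨_, Submodule.smul_of_tower_mem _ a (T ()).2⟩, by simp, ?_⟩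
      set g : aug Unit n R := ⟨_, Submodule.smul_of_tower_mem _ a (T ()).2⟩ with hg
      have h1 := F.add_sub_add_mem (comp g (T (0 : Fin 2))) (comp g (T 1))
      have h2 := Submodule.smul_of_tower_mem _ a F.law_sub_mem
      have hcomp : ∀ x : aug (Fin 2) n R, (comp g x : TruncPoly (Fin 2) n R) = a • x := by
        intro x
        rw [coe_comp, hg]
        simp
      have h3 := sub_mem h2 h1
      rw [defect]
      convert h3 using 1
      rw [hcomp, hcomp, hcomp, smul_sub, smul_sub]
      ring
    · obtain ⟨g, hfg, hg⟩ := F.exists_defect_mem_succ hp hM hf (h f)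
      refine ⟨g, ?_, hg⟩
      convert sub_mem hfa (aug_pow_le (by omega : 2 ≤ m + 1) hfg) using 1
      ring

end

end BudLaw

/-! ### Powers, compositional inverses and Frobenius. -/

namespace TruncPoly

section

variable {σ τ υ : Type*} {n : ℕ} {R S : Type*} [CommRing R] [CommRing S]

/-- The power `x ^ k`, as a truncated polynomial with zero constant term. -/
def powAug (x : aug σ n R) (k : ℕ) (hk : k ≠ 0) : aug σ n R :=
  ⟨(x : TruncPoly σ n R) ^ k, Ideal.pow_mem_of_mem _ x.2 k (Nat.pos_of_ne_zero hk)⟩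

@[simp] lemma coe_powAug (x : aug σ n R) (k : ℕ) (hk : k ≠ 0) :
    (powAug x k hk : TruncPoly σ n R) = (x : TruncPoly σ n R) ^ k := rfl

lemma substAug_powAug (g : σ → aug τ n R) (x : aug σ n R) (k : ℕ) (hk : k ≠ 0) :
    substAug g (powAug x k hk) = powAug (substAug g x) k hk :=
  Subtype.ext (map_pow (subst g) _ _)

lemma mapAug_powAug (φ : R →+* S) (x : aug σ n R) (k : ℕ) (hk : k ≠ 0) :
    mapAug φ (powAug x k hk) = powAug (mapAug φ x) k hk :=
  Subtype.ext (map_pow (map φ) _ _)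

lemma comp_powAug_comp (f : aug Unit n R) (k : ℕ) (hk : k ≠ 0) (x : aug σ n R) :
    comp (comp f (powAug (T ()) k hk)) x = comp f (powAug x k hk) := by
  rw [comp_comp]
  congr 1
  exact (substAug_powAug _ _ _ _).trans (by rw [substAug_T])

lemma subst_mem_aug_pow_mul {g : σ → aug τ n R} {k : ℕ}
    (hg : ∀ s, (g s : TruncPoly τ n R) ∈ aug τ n R ^ k) {m : ℕ} {a : TruncPoly σ n R}
    (ha : a ∈ aug σ n R ^ m) : subst g a ∈ aug τ n R ^ (k * m) := by
  have h : (aug σ n R).map (subst g) ≤ aug τ n R ^ k := by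
    change ((MvPolynomial.idealOfVars σ R).map (mk σ n R)).map _ ≤ _
    rw [Ideal.map_span, Ideal.map_span, Ideal.span_le]
    rintro _ ⟨_, ⟨_, ⟨s, rfl⟩, rfl⟩, rfl⟩
    simpa using hg s
  have h2 := Ideal.mem_map_of_mem (subst g) ha
  rw [Ideal.map_pow] at h2
  rw [pow_mul]
  exact Ideal.pow_right_mono h m h2

lemma comp_eq_sum (f : aug Unit n R) (x : aug σ n R) :
    (comp f x : TruncPoly σ n R) = ∑ i ∈ Finset.range (n + 1),
      coeff (Finsupp.single () i) (f : TruncPoly Unit n R) • (x : TruncPoly σ n R) ^ i := by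
  rw [coe_comp]
  conv_lhs => rw [eq_sum_coeff (f : TruncPoly Unit n R)]
  simp

lemma natCast_eq_zero {p : ℕ} (hp : (p : R) = 0) : (p : TruncPoly σ n R) = 0 := by
  rw [← map_natCast (algebraMap R (TruncPoly σ n R)), hp, map_zero]

lemma coeff_map (φ : R →+* S) {d : σ →₀ ℕ} (hd : d.degree ≤ n) (x : TruncPoly σ n R) :
    coeff d (map φ x) = φ (coeff d x) := by
  obtain ⟨q, rfl⟩ := mk_surjective x
  rw [map_mk, coeff_mk _ _ hd, coeff_mk _ _ hd, MvPolynomial.coeff_map]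

lemma coeff_smul (r : R) {d : σ →₀ ℕ} (hd : d.degree ≤ n) (x : TruncPoly σ n R) :
    coeff d (r • x) = r * coeff d x := by
  obtain ⟨q, rfl⟩ := mk_surjective x
  rw [← map_smul, coeff_mk _ _ hd, coeff_mk _ _ hd, MvPolynomial.coeff_smul, smul_eq_mul]

lemma sub_smul_T_mem (hn : 1 ≤ n) (f : aug Unit n R) :
    (f : TruncPoly Unit n R) - coeff (Finsupp.single () 1) (f : TruncPoly Unit n R) •
      ((T () : aug Unit n R) : TruncPoly Unit n R) ∈ aug Unit n R ^ 2 := by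
  have := sub_smul_T_pow_mem hn (x := f) (by rw [pow_one]; exact f.2)
  rwa [pow_one] at this

lemma coeff_one_comp (hn : 1 ≤ n) (f g : aug Unit n R) :
    coeff (Finsupp.single () 1) (comp f g : TruncPoly Unit n R) =
      coeff (Finsupp.single () 1) (f : TruncPoly Unit n R) *
        coeff (Finsupp.single () 1) (g : TruncPoly Unit n R) := by
  have h := subst_mem_aug_pow (fun _ => g) 2 (sub_smul_T_mem hn f)
  rw [map_sub, map_smul, subst_T] at h
  rw [coe_comp, coeff_eq_of_sub_mem (by omega) h (by simp), coeff_smul _ (by simpa using hn)]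

/-- Successive approximation: if `f(g) - T` has order `k + 1`, subtracting `a₁⁻¹ (f(g) - T)` from
`g` raises that order by one, and order `n + 1` is zero. -/
lemma exists_comp_eq_T (hn : 1 ≤ n) (f : aug Unit n R)
    (hf : IsUnit (coeff (Finsupp.single () 1) (f : TruncPoly Unit n R))) :
    ∃ g : aug Unit n R, comp f g = T () := by
  obtain ⟨u, hu⟩ := hf.exists_left_inv
  set a := coeff (Finsupp.single () 1) (f : TruncPoly Unit n R) with ha
  have key : ∀ k, ∃ g : aug Unit n R,
      (comp f g : TruncPoly Unit n R) - (T () : aug Unit n R) ∈ aug Unit n R ^ (k + 1) := by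
    intro k
    induction k with
    | zero => exact ⟨0, by rw [_root_.zero_add, pow_one]; exact sub_mem (comp f 0).2 (T ()).2⟩
    | succ k ih =>
      obtain ⟨g, hg⟩ := ih
      have hue := Submodule.smul_of_tower_mem _ u hg
      refine ⟨⟨_, sub_mem g.2 (Ideal.pow_le_self (by omega) hue)⟩, ?_⟩
      have h := subst_sub_subst_mem_aug_pow (g := fun _ : Unit => (⟨_, sub_mem g.2
        (Ideal.pow_le_self (by omega) hue)⟩ : aug Unit n R)) (g' := fun _ => g) (k := k)
        (fun _ => by rw [sub_sub_cancel_left, neg_mem_iff]; exact hue) (sub_smul_T_mem hn f)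
      simp only [map_sub, map_smul, subst_T] at h
      rw [_root_.add_comm 2 k, ← ha] at h
      rw [smul_sub a, smul_smul, mul_comm a u, hu, one_smul, ← coe_comp, ← coe_comp] at h
      convert h using 1
      ring
  obtain ⟨g, hg⟩ := key n
  rw [aug_pow, Ideal.mem_bot, sub_eq_zero] at hg
  exact ⟨g, Subtype.ext hg⟩

end

section

variable {σ τ : Type*} {n : ℕ} {p : ℕ} [Fact p.Prime] {A : Type*} [CommRing A]

lemma exists_frobenius {B : Type*} [CommRing B] (hp : (p : B) = 0) (j : ℕ) :
    ∃ φ : B →+* B, ∀ x, φ x = x ^ p ^ j := by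
  rcases subsingleton_or_nontrivial B with _ | _
  · exact ⟨RingHom.id B, fun x => Subsingleton.elim _ _⟩
  · have := (CharP.charP_iff_prime_eq_zero (R := B) (Fact.out : p.Prime)).2 hp
    exact ⟨iterateFrobenius B p j, fun x => iterateFrobenius_def p j x⟩

/-- Coefficients coming from `𝔽_p` are fixed by Frobenius. This is why `x ↦ x^(p^j)` respects a bud
law defined over `𝔽_p`. -/
lemma subst_map_pow (φ : ZMod p →+* A) (g : σ → aug τ n A) (j : ℕ)
    (hq : p ^ j ≠ 0) (a : TruncPoly σ n (ZMod p)) :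
    subst g (map φ a) ^ p ^ j = subst (fun s => powAug (g s) (p ^ j) hq) (map φ a) := by
  have hp : (p : A) = 0 := by rw [← map_natCast φ]; simp
  obtain ⟨ψ, hψ⟩ := exists_frobenius (p := p) (natCast_eq_zero (σ := τ) (n := n) hp) j
  obtain ⟨a, rfl⟩ := mk_surjective a
  have : (ψ.comp ((subst g : TruncPoly σ n A →+* TruncPoly τ n A).comp (map φ))).comp
      (mk σ n (ZMod p) : MvPolynomial σ (ZMod p) →+* TruncPoly σ n (ZMod p)) =
      ((subst (fun s => powAug (g s) (p ^ j) hq) : TruncPoly σ n A →+* TruncPoly τ n A).comp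
        (map φ)).comp
        (mk σ n (ZMod p) : MvPolynomial σ (ZMod p) →+* TruncPoly σ n (ZMod p)) := by
    refine MvPolynomial.ringHom_ext' (Subsingleton.elim _ _) fun s => ?_
    have e : map φ (mk σ n (ZMod p) (MvPolynomial.X s)) =
      ((T s : aug σ n A) : TruncPoly σ n A) := map_T φ s
    simp only [RingHom.comp_apply, RingHom.coe_coe, e, subst_T, hψ, coe_powAug]
  rw [← hψ]
  exact DFunLike.congr_fun this a

lemma powAug_pow_char (hp : (p : A) = 0) (f : aug Unit n A) (j : ℕ) :
    (f : TruncPoly Unit n A) ^ p ^ j = ∑ i ∈ Finset.range (n + 1),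
      coeff (Finsupp.single () i) (f : TruncPoly Unit n A) ^ p ^ j •
        ((T () : aug Unit n A) : TruncPoly Unit n A) ^ (p ^ j * i) := by
  obtain ⟨ψ, hψ⟩ := exists_frobenius (p := p) (natCast_eq_zero (σ := Unit) (n := n) hp) j
  rw [← hψ]
  conv_lhs => rw [eq_sum_coeff (f : TruncPoly Unit n A)]
  rw [map_sum]
  refine Finset.sum_congr rfl fun i _ => ?_
  rw [hψ, smul_pow, ← pow_mul, mul_comm]

end

end TruncPoly

/-! ### Endomorphisms, and the consequences of `[p](T) = T^(p^h)`. -/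

namespace BudLaw

open TruncPoly

section

variable {σ τ υ : Type*} {n : ℕ} {R S : Type*} [CommRing R] [CommRing S] (F : BudLaw n R)

lemma comp_add_of_defect {f : aug Unit n R} (hf : F.defect f = 0) (x y : aug σ n R) :
    comp f (F.add x y) = F.add (comp f x) (comp f y) := by
  have := F.subst_defect f x y
  rw [hf, map_zero] at this
  exact Subtype.ext (sub_eq_zero.1 this.symm)

lemma comp_nsum_of_defect {f : aug Unit n R} (hf : F.defect f = 0) (x : aug σ n R) (m : ℕ) :
    comp f (F.nsum x m) = F.nsum (comp f x) m := by
  induction m with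
  | zero => exact comp_zero f
  | succ m ih => rw [nsum, F.comp_add_of_defect hf, ih, nsum]

lemma defect_eq_zero_iff {f : aug Unit n R} : F.defect f = 0 ↔
    comp f (F.add (T (0 : Fin 2)) (T 1)) = F.add (comp f (T 0)) (comp f (T 1)) := by
  rw [defect, sub_eq_zero, add_T]
  exact Subtype.ext_iff.symm

lemma comp_add_left (f g : aug Unit n R) (x : aug σ n R) :
    comp (F.add f g) x = F.add (comp f x) (comp g x) := substAug_add F _ f g

/-- Commutativity of `F` is what makes endomorphisms closed under formal addition; this provides `T
+_F g`. -/
lemma defect_add_eq_zero {f g : aug Unit n R} (hf : F.defect f = 0) (hg : F.defect g = 0) :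
    F.defect (F.add f g) = 0 := by
  rw [defect_eq_zero_iff, comp_add_left, comp_add_left, comp_add_left, F.comp_add_of_defect hf,
    F.comp_add_of_defect hg, F.add_add_add_comm]

lemma defect_T : F.defect (T ()) = 0 := by
  rw [defect_eq_zero_iff, T_comp, T_comp, T_comp]

/-- Endomorphisms with invertible leading coefficient are automorphisms. -/
lemma exists_aut (hn : 1 ≤ n) {f : aug Unit n R} (hf : F.defect f = 0)
    (hu : IsUnit (coeff (Finsupp.single () 1) (f : TruncPoly Unit n R))) :
    ∃ e : F.Aut, e.toTruncEnd.poly = f := by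
  obtain ⟨g, hg⟩ := exists_comp_eq_T hn f hu
  have h1 := coeff_one_comp hn f g
  have hT : coeff (Finsupp.single () 1) ((T () : aug Unit n R) : TruncPoly Unit n R) = 1 := by
    have := coeff_smul_T_pow (1 : R) (i := 1) hn
    rwa [pow_one, one_smul, if_pos rfl] at this
  rw [hg, hT] at h1
  -- A right inverse of the right inverse `g` must be `f`, so `g` is two-sided.
  obtain ⟨f', hf'⟩ := exists_comp_eq_T hn g (IsUnit.of_mul_eq_one_right _ h1.symm)
  have hff' : f' = f := by
    rw [← T_comp f', ← hg, comp_comp, hf', comp_T]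
  rw [hff'] at hf'
  have hgd : F.defect g = 0 := by
    rw [defect_eq_zero_iff]
    have h2 : ∀ x : aug (Fin 2) n R, comp f (comp g x) = x := fun x => by
      rw [← comp_comp, hg, T_comp]
    have h3 : ∀ x : aug (Fin 2) n R, comp g (comp f x) = x := fun x => by
      rw [← comp_comp, hf', T_comp]
    rw [← h3 (F.add (comp g _) _), F.comp_add_of_defect hf, h2, h2]
  refine ⟨⟨⟨⟨f⟩, F.mem_End_iff_defect.2 hf⟩, ⟨⟨g⟩, F.mem_End_iff_defect.2 hgd⟩, ?_, ?_⟩, rfl⟩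
  · exact Subtype.ext (TruncEnd.ext hg)
  · exact Subtype.ext (TruncEnd.ext hf')

end

section

variable {n p h : ℕ} [Fact p.Prime] {A : Type*} [CommRing A]

lemma add_powAug {σ : Type*} (F : BudLaw n (ZMod p)) (φ : ZMod p →+* A) (j : ℕ) (hq : p ^ j ≠ 0)
    (x y : aug σ n A) :
    powAug ((F.map φ).add x y) (p ^ j) hq =
      (F.map φ).add (powAug x (p ^ j) hq) (powAug y (p ^ j) hq) := by
  apply Subtype.ext
  refine (subst_map_pow φ ![x, y] j hq (F.law : TruncPoly (Fin 2) n (ZMod p))).trans ?_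
  exact subst_congr (fun s => by fin_cases s <;> rfl) _

lemma nsum_eq_powAug {σ : Type*} (F : BudLaw n (ZMod p)) (hq : p ^ h ≠ 0)
    (hF : F.nsum (T ()) p = powAug (T ()) (p ^ h) hq) (φ : ZMod p →+* A) (x : aug σ n A) :
    (F.map φ).nsum x p = powAug x (p ^ h) hq := by
  have h1 := congrArg (mapAug φ) hF
  rw [mapAug_nsum, mapAug_powAug, mapAug_T] at h1
  have h2 := congrArg (substAug fun _ => x) h1
  rwa [substAug_nsum, substAug_powAug, substAug_T] at h2

/-- The coefficients of an endomorphism of a law of height `h`. -/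
lemma coeff_pow_eq_of_defect (F : BudLaw n (ZMod p)) (hq : p ^ h ≠ 0)
    (hF : F.nsum (T ()) p = powAug (T ()) (p ^ h) hq) (φ : ZMod p →+* A) {f : aug Unit n A}
    (hf : (F.map φ).defect f = 0) {i : ℕ} (hi : p ^ h * i ≤ n) :
    coeff (Finsupp.single () i) (f : TruncPoly Unit n A) ^ p ^ h =
      coeff (Finsupp.single () i) (f : TruncPoly Unit n A) := by
  have hp : (p : A) = 0 := by rw [← map_natCast φ]; simp
  -- Commutation with `[p]` reads `f(T^(p^h)) = f(T)^(p^h)`; the coefficients of `T^(p^h * i)` are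
  -- `a_i` and `a_i^(p^h)`.
  have h1 := (F.map φ).comp_nsum_of_defect hf (T ()) p
  rw [nsum_eq_powAug F hq hF, nsum_eq_powAug F hq hF, comp_T] at h1
  have h2 := congrArg Subtype.val h1
  rw [comp_eq_sum, coe_powAug, coe_powAug, powAug_pow_char hp f h] at h2
  simp only [← pow_mul] at h2
  have h3 := congrArg (coeff (Finsupp.single () (p ^ h * i))) h2
  have hin : i < n + 1 := by
    have := Nat.pos_of_ne_zero hq
    nlinarith
  simp only [map_sum, coeff_smul_T_pow _ hi, Nat.mul_right_inj hq, Finset.sum_ite_eq,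
    Finset.mem_range, if_pos hin] at h3
  exact h3.symm

/-- Under either alternative every `f` commutes with `T^(p^h)` to the order required: both
composites have order at least `p^h > M`, or all coefficients are fixed by the `p^h`-power map and
the composites coincide. -/
lemma exists_defect_mem_of_height (F : BudLaw n (ZMod p)) (hq : p ^ h ≠ 0)
    (hF : F.nsum (T ()) p = powAug (T ()) (p ^ h) hq) (φ : ZMod p →+* A) {M : ℕ} (hM : M ≤ n)
    (hA : M < p ^ h ∨ ∀ a : A, a ^ p ^ h = a) (a : A) :
    ∃ f : aug Unit n A,
      (f : TruncPoly Unit n A) - a • ((T () : aug Unit n A) : TruncPoly Unit n A) ∈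
        aug Unit n A ^ 2 ∧ (F.map φ).defect f ∈ aug (Fin 2) n A ^ (M + 1) := by
  have hp : (p : A) = 0 := by rw [← map_natCast φ]; simp
  refine (F.map φ).exists_defect_mem hp hM (fun f => ?_) a
  rw [nsum_eq_powAug F hq hF, nsum_eq_powAug F hq hF]
  rcases hA with hA | hA
  · refine sub_mem (aug_pow_le (by omega : M + 1 ≤ p ^ h * 1) ?_)
      (aug_pow_le (by omega : M + 1 ≤ p ^ h) (pow_mem_aug_pow f _))
    exact subst_mem_aug_pow_mul (fun _ => pow_mem_aug_pow (T ()) _) (by rw [pow_one]; exact f.2)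
  · rw [comp_eq_sum, coe_powAug, coe_powAug, powAug_pow_char hp f h]
    simp only [← pow_mul, hA, sub_self, Submodule.zero_mem]

/-- Composition with a power of the Frobenius endomorphism. -/
lemma defect_comp_powAug (F : BudLaw n (ZMod p)) (φ : ZMod p →+* A) (j : ℕ) (hj : p ^ j ≠ 0)
    {M : ℕ} (hM : n < p ^ j * (M + 1)) {f : aug Unit n A}
    (hf : (F.map φ).defect f ∈ aug (Fin 2) n A ^ (M + 1)) :
    (F.map φ).defect (comp f (powAug (T ()) (p ^ j) hj)) = 0 := by
  -- Evaluating the defect at `p^j`-th powers multiplies its order by `p^j`, which pushes it beyond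
  -- `n`.
  have h1 := subst_mem_aug_pow_mul (k := p ^ j)
    (g := ![powAug (T (0 : Fin 2)) (p ^ j) hj, powAug (T 1) (p ^ j) hj])
    (fun s => by fin_cases s <;> exact pow_mem_aug_pow _ _) hf
  rw [aug_pow_eq_bot hM, Ideal.mem_bot, subst_defect, sub_eq_zero] at h1
  rw [defect_eq_zero_iff, comp_powAug_comp, comp_powAug_comp, comp_powAug_comp, add_powAug]
  exact Subtype.ext h1

end

end BudLaw

/-! ### Multiplication by `m` on the truncation of a formal group law. -/

namespace FormalGroup

open TruncPoly

section

variable {R : Type*} [CommRing R] (F : FormalGroup R) [F.IsComm]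

lemma nsum_truncation (n m : ℕ) :
    ((F.truncation n).nsum (T ()) m : TruncPoly Unit n R) = ofPowerSeries n (F.mulSeries m) := by
  induction m with
  | zero => rw [mulSeries_zero]; exact ofPowerSeries_zero.symm
  | succ m ih =>
    rw [mulSeries_succ]
    exact (ofPowerSeries_subst_pair _ _ _ _ _ ih.symm (ofPowerSeries_X ())).symm

lemma nsum_truncation_eq_powAug {m k : ℕ} (hk : k ≠ 0)
    (h : F.mulSeries m = (PowerSeries.X : PowerSeries R) ^ k) (n : ℕ) :
    (F.truncation n).nsum (T ()) m = powAug (T ()) k hk := by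
  apply Subtype.ext
  rw [nsum_truncation, h, ← ofPowerSeriesHom_apply, map_pow, coe_powAug, ofPowerSeriesHom_apply]
  exact congrArg (· ^ k) (ofPowerSeries_X ())

end

end FormalGroup

/-! ### The filtration in terms of leading coefficients. -/

namespace BudLaw

open TruncPoly

section

variable {n : ℕ} {R S : Type*} [CommRing R] [CommRing S] (F : BudLaw n R)

lemma mapAug_defect (φ : R →+* S) (f : aug Unit n R) :
    TruncPoly.map φ (F.defect f) = (F.map φ).defect (mapAug φ f) := by
  rw [defect, map_sub, ← coe_mapAug, ← coe_mapAug, mapAug_comp, mapAug_add, mapAug_comp,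
    mapAug_comp, mapAug_T, mapAug_T]
  rfl

lemma map_map_eq {k : Type*} [CommRing k] (F : BudLaw n k) (φ : k →+* R) (ψ : R →+* S)
    (χ : k →+* S) (h : ψ.comp φ = χ) : (F.map φ).map ψ = F.map χ := by
  subst h
  exact BudLaw.ext (Subtype.ext (map_map φ ψ _))

lemma defect_aut (f : F.Aut) : F.defect f.toTruncEnd.poly = 0 :=
  F.mem_End_iff_defect.1 (f : F.End).2

lemma coeff_toTruncEnd (f : F.Aut) (k : ℕ) : f.toTruncEnd.coeff k =
    TruncPoly.coeff (Finsupp.single () k) (f.toTruncEnd.poly : TruncPoly Unit n R) := rfl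

lemma coeff_single_T {k : ℕ} (hk : k ≤ n) :
    TruncPoly.coeff (Finsupp.single () k) ((T () : aug Unit n R) : TruncPoly Unit n R) =
      if k = 1 then 1 else 0 := by
  have := coeff_smul_T_pow (1 : R) (i := 1) hk
  rwa [pow_one, one_smul] at this

lemma mem_autFiltration_zero (f : F.Aut) : f ∈ F.autFiltration 0 := by
  rw [mem_autFiltration, TruncEnd.IsCloseToId, _root_.zero_add, pow_one]
  exact sub_mem f.toTruncEnd.poly.2 (T ()).2

lemma mem_autFiltration_one_iff (hn : 1 ≤ n) (f : F.Aut) :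
    f ∈ F.autFiltration 1 ↔ f.toTruncEnd.coeff 1 = 1 := by
  have h := sub_smul_T_mem hn f.toTruncEnd.poly
  rw [← coeff_toTruncEnd] at h
  rw [mem_autFiltration, TruncEnd.IsCloseToId]
  constructor
  · intro h1
    rw [coeff_toTruncEnd, coeff_eq_of_sub_mem (by omega) h1 (by simp), coeff_single_T hn,
      if_pos rfl]
  · intro h1
    rwa [h1, one_smul] at h

lemma sub_T_sub_mem {i : ℕ} (hi : 1 ≤ i) (hn : i + 1 ≤ n) {f : F.Aut}
    (hf : f ∈ F.autFiltration i) :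
    (f.toTruncEnd.poly : TruncPoly Unit n R) - (T () : aug Unit n R) -
      f.toTruncEnd.coeff (i + 1) • ((T () : aug Unit n R) : TruncPoly Unit n R) ^ (i + 1) ∈
      aug Unit n R ^ (i + 2) := by
  have h := sub_smul_T_pow_mem hn ((mem_autFiltration).1 hf)
  rwa [map_sub, coeff_single_T hn, if_neg (by omega), sub_zero, ← coeff_toTruncEnd] at h

lemma mem_autFiltration_succ_iff {i : ℕ} (hi : 1 ≤ i) (hn : i + 1 ≤ n) {f : F.Aut}
    (hf : f ∈ F.autFiltration i) :
    f ∈ F.autFiltration (i + 1) ↔ f.toTruncEnd.coeff (i + 1) = 0 := by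
  have h := F.sub_T_sub_mem hi hn hf
  constructor
  · intro h1
    rw [coeff_toTruncEnd, coeff_eq_of_sub_mem (by omega) ((mem_autFiltration).1 h1) (by simp),
      coeff_single_T hn, if_neg (by omega)]
  · intro h1
    rwa [h1, zero_smul, sub_zero] at h

/-- Write `f(g) = g + (f - T)(g)`. Since `g ≡ T` modulo order `2`, replacing `(f - T)(g)` by `f - T`
costs only order `i + 2`. -/
lemma coeff_succ_mul {i : ℕ} (hi : 1 ≤ i) (hn : i + 1 ≤ n) {f g : F.Aut}
    (hf : f ∈ F.autFiltration i) (hg : g ∈ F.autFiltration i) :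
    (f * g).toTruncEnd.coeff (i + 1) =
      f.toTruncEnd.coeff (i + 1) + g.toTruncEnd.coeff (i + 1) := by
  have h1 := subst_sub_subst_mem_aug_pow (g := fun _ : Unit => g.toTruncEnd.poly) (g' := T)
    (k := 1) (fun _ => aug_pow_le (by omega) ((mem_autFiltration).1 hg))
    ((mem_autFiltration).1 hf)
  rw [subst_self, map_sub, subst_T] at h1
  have h2 : subst (fun _ : Unit => g.toTruncEnd.poly) (f.toTruncEnd.poly : TruncPoly Unit n R) =
    (f * g).toTruncEnd.poly := rfl
  rw [h2] at h1
  have h3 := (mem_aug_pow_iff (by omega) _).1 h1 (Finsupp.single () (i + 1)) (by simp)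
  rw [map_sub, map_sub, map_sub, coeff_single_T hn, if_neg (by omega)] at h3
  simp only [coeff_toTruncEnd]
  linear_combination h3

/-- Outside of the powers of `p`, the filtration does not jump. -/
lemma coeff_succ_eq_zero {p : ℕ} [Fact p.Prime] (hp : (p : R) = 0) {i : ℕ} (hi : 1 ≤ i)
    (hn : i + 1 ≤ n) (hpow : ∀ j, i + 1 ≠ p ^ j) {f : F.Aut} (hf : f ∈ F.autFiltration i) :
    f.toTruncEnd.coeff (i + 1) = 0 := by
  set a := f.toTruncEnd.coeff (i + 1) with ha
  have h := F.sub_T_sub_mem hi hn hf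
  have hcomp : ∀ x : aug (Fin 2) n R, (comp f.toTruncEnd.poly x : TruncPoly (Fin 2) n R) - x -
      a • (x : TruncPoly (Fin 2) n R) ^ (i + 1) ∈ aug (Fin 2) n R ^ (i + 2) := by
    intro x
    have := subst_mem_aug_pow (fun _ => x) _ h
    rwa [map_sub, map_sub, map_smul, map_pow, subst_T] at this
  have hclose : ∀ x : aug (Fin 2) n R, (comp f.toTruncEnd.poly x : TruncPoly (Fin 2) n R) - x ∈
      aug (Fin 2) n R ^ (i + 1) := by
    intro x
    have := add_mem (aug_pow_le (by omega : i + 1 ≤ i + 2) (hcomp x))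
      (Submodule.smul_of_tower_mem _ a (pow_mem_aug_pow x (i + 1)))
    rwa [sub_add_cancel] at this
  have h1 := F.add_sub_mem (hclose (T 0)) (hclose (T 1))
  have h2 := subst_sub_subst_mem_aug_pow (g := fun _ : Unit => F.law)
    (g' := fun _ => T 0 + T 1) (k := 1)
    (fun _ => by simpa [sub_sub] using F.law_sub_mem)
    (pow_mem_aug_pow (T () : aug Unit n R) (i + 1))
  rw [map_pow, map_pow, subst_T, subst_T] at h2
  have h3 := Submodule.smul_of_tower_mem _ a h2
  have h4 := F.defect_aut f
  rw [defect] at h4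
  have h5 : a • ((((T 0 : aug (Fin 2) n R) : TruncPoly (Fin 2) n R) +
        ((T 1 : aug (Fin 2) n R) : TruncPoly (Fin 2) n R)) ^ (i + 1) -
        ((T 0 : aug (Fin 2) n R) : TruncPoly (Fin 2) n R) ^ (i + 1) -
        ((T 1 : aug (Fin 2) n R) : TruncPoly (Fin 2) n R) ^ (i + 1)) ∈
        aug (Fin 2) n R ^ (i + 2) := by
    have h6 := add_mem (sub_mem (sub_mem (hcomp (T 0)) (hcomp F.law)) h3)
      (add_mem (hcomp (T 1)) h1)
    convert h6 using 1
    rw [F.add_T, smul_sub, smul_sub, smul_sub, Submodule.coe_add]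
    linear_combination h4
  set γ : ℕ → R := fun j => if j = 0 ∨ j = i + 1 then 0 else a * (i + 1).choose j with hγ
  rw [← binForm_eq_of_choose (γ := γ) (c := a) (by omega) (by simp [hγ]) (by simp [hγ])
    (fun j h0 h1 => by rw [hγ]; exact if_neg (by omega))] at h5
  obtain ⟨j, hj0, hj1, hj⟩ := exists_not_dvd_choose (p := p) (by omega) hpow
  have h6 := eq_zero_of_binForm_mem γ hn h5 hj1.le
  rw [hγ] at h6
  simp only at h6
  rw [if_neg (by omega)] at h6
  exact (isUnit_cast_of_not_dvd hp hj).mul_left_eq_zero.1 h6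

end

/-! ### Automorphisms with prescribed leading coefficient. -/

section

variable {n p h : ℕ} [Fact p.Prime] {A : Type*} [CommRing A]

/-- The corrections made during the construction introduce new coefficients, which must be fixed by
Frobenius too. Working over the subring `B` of all fixed elements, which contains `a`, guarantees
this; the result is then extended to `A`. -/
lemma exists_defect_mem_of_pow_eq (F : BudLaw n (ZMod p)) (hq : p ^ h ≠ 0)
    (hF : F.nsum (T ()) p = powAug (T ()) (p ^ h) hq) (φ : ZMod p →+* A) {M : ℕ} (hM : M ≤ n)
    (a : A) (hA : M < p ^ h ∨ a ^ p ^ h = a) :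
    ∃ f : aug Unit n A,
      (f : TruncPoly Unit n A) - a • ((T () : aug Unit n A) : TruncPoly Unit n A) ∈
        aug Unit n A ^ 2 ∧ (F.map φ).defect f ∈ aug (Fin 2) n A ^ (M + 1) := by
  rcases hA with hA | hA
  · exact exists_defect_mem_of_height F hq hF φ hM (Or.inl hA) a
  · have hp : (p : A) = 0 := by rw [← map_natCast φ]; simp
    obtain ⟨ψ, hψ⟩ := exists_frobenius (p := p) hp h
    let B : Subring A := ψ.eqLocus (RingHom.id A)
    have haB : a ∈ B := (hψ a).trans hA
    let φ' : ZMod p →+* B := φ.codRestrict B fun x =>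
      DFunLike.congr_fun (Subsingleton.elim (ψ.comp φ) φ) x
    obtain ⟨f, hf1, hf2⟩ := exists_defect_mem_of_height F hq hF φ' hM
      (Or.inr fun b => Subtype.ext ((hψ b).symm.trans b.2)) ⟨a, haB⟩
    refine ⟨mapAug B.subtype f, ?_, ?_⟩
    · have := map_mem_aug_pow B.subtype 2 hf1
      rwa [map_sub, Algebra.smul_def, map_mul, TruncPoly.map_algebraMap, map_T, ← Algebra.smul_def] at this
    · have := map_mem_aug_pow B.subtype (M + 1) hf2
      rwa [mapAug_defect, map_map_eq F φ' B.subtype φ (RingHom.ext fun _ => rfl)] at this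

/-- Automorphisms with prescribed multiplier. -/
lemma exists_aut_coeff_one (F : BudLaw n (ZMod p)) (hq : p ^ h ≠ 0)
    (hF : F.nsum (T ()) p = powAug (T ()) (p ^ h) hq) (φ : ZMod p →+* A) (hn : 1 ≤ n)
    (a : A) (hu : IsUnit a) (ha : a ^ p ^ h = a) :
    ∃ f : (F.map φ).Aut, f.toTruncEnd.coeff 1 = a := by
  obtain ⟨f, hf1, hf2⟩ := exists_defect_mem_of_pow_eq F hq hF φ le_rfl a (Or.inr ha)
  rw [aug_pow, Ideal.mem_bot] at hf2
  have h1 : TruncPoly.coeff (Finsupp.single () 1) (f : TruncPoly Unit n A) = a := by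
    rw [coeff_eq_of_sub_mem (by omega) hf1 (by simp), coeff_smul _ (by simpa using hn),
      coeff_single_T hn, if_pos rfl, mul_one]
  obtain ⟨e, he⟩ := (F.map φ).exists_aut hn hf2 (by rwa [h1])
  exact ⟨e, by rw [coeff_toTruncEnd, he, h1]⟩

/-- Automorphisms `T + a T^(p^j) + ⋯`. -/
lemma exists_aut_coeff_pow (F : BudLaw n (ZMod p)) (hq : p ^ h ≠ 0)
    (hF : F.nsum (T ()) p = powAug (T ()) (p ^ h) hq) (φ : ZMod p →+* A) {j : ℕ} (hj : 1 ≤ j)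
    (hn : p ^ j ≤ n) (a : A) (ha : n / p ^ j < p ^ h ∨ a ^ p ^ h = a) :
    ∃ f ∈ (F.map φ).autFiltration (p ^ j - 1), f.toTruncEnd.coeff (p ^ j - 1 + 1) = a := by
  have hQ : 2 ≤ p ^ j := (Fact.out : p.Prime).two_le.trans (Nat.le_self_pow (by omega) p)
  -- `M = n / p^j` is the least order with `p^j * (M + 1) > n`, so the composite with `T^(p^j)` has
  -- zero defect.
  obtain ⟨f, hf1, hf2⟩ := exists_defect_mem_of_pow_eq F hq hF φ (Nat.div_le_self n (p ^ j)) a ha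
  obtain ⟨k, hk⟩ : ∃ k, p ^ j = k + 1 := ⟨p ^ j - 1, by omega⟩
  set g := comp f (powAug (T ()) (p ^ j) (by omega)) with hg
  have hgd : (F.map φ).defect g = 0 :=
    defect_comp_powAug F φ j (by omega) (Nat.lt_mul_div_succ n (by omega)) hf2
  have h1 : (g : TruncPoly Unit n A) - a • ((T () : aug Unit n A) : TruncPoly Unit n A) ^ p ^ j ∈
      aug Unit n A ^ (p ^ j + 1) := by
    have := subst_mem_aug_pow_mul (k := p ^ j) (g := fun _ : Unit => powAug (T ()) (p ^ j)
      (by omega)) (fun _ => pow_mem_aug_pow (T ()) _) hf1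
    rw [map_sub, map_smul, subst_T] at this
    exact aug_pow_le (by omega) this
  have hTQ := Submodule.smul_of_tower_mem _ a (pow_mem_aug_pow (T () : aug Unit n A) (p ^ j))
  have hgQ : (g : TruncPoly Unit n A) ∈ aug Unit n A ^ p ^ j := by
    have := add_mem (aug_pow_le (Nat.le_succ _) h1) hTQ
    rwa [sub_add_cancel] at this
  -- `g` is viewed as a perturbation of `0` of order `p^j`, giving `T +_F g ≡ T + g` modulo order
  -- `p^j + 1`.
  have h2 := (F.map φ).add_sub_mem (k := k) (x := T ()) (x' := T ()) (y := 0) (y' := g)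
    (by simp) (by rw [← hk]; simpa using hgQ)
  rw [add_zero, sub_self, sub_zero, Submodule.coe_zero, sub_zero,
    show k + 2 = p ^ j + 1 by omega] at h2
  have h3 := add_mem h2 h1
  have h4 : ((F.map φ).add (T ()) g : TruncPoly Unit n A) - (T () : aug Unit n A) ∈
      aug Unit n A ^ p ^ j := by
    have := add_mem (aug_pow_le (Nat.le_succ _) h2) hgQ
    rwa [sub_add_cancel] at this
  obtain ⟨e, he⟩ := (F.map φ).exists_aut (by omega)
    ((F.map φ).defect_add_eq_zero (F.map φ).defect_T hgd) (by
      rw [coeff_eq_of_sub_mem (by omega) h4 (by simp; omega), coeff_single_T (by omega),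
        if_pos rfl]
      exact isUnit_one)
  refine ⟨e, ?_, ?_⟩
  · rw [mem_autFiltration, TruncEnd.IsCloseToId, he, Nat.sub_add_cancel (by omega)]
    exact h4
  · rw [coeff_toTruncEnd, he, Nat.sub_add_cancel (by omega)]
    rw [sub_add_sub_cancel, sub_sub] at h3
    rw [coeff_eq_of_sub_mem (by omega) h3 (by simp), map_add, coeff_single_T hn,
      if_neg (by omega), coeff_smul_T_pow _ hn, if_pos rfl, _root_.zero_add]

end

end BudLaw

/-! ### The graded pieces as functors on `𝔽_p`-algebras. -/

namespace BudLaw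

open TruncPoly

section

variable {n : ℕ} {k : Type} [CommRing k] (F : BudLaw n k)

lemma coeff_filtMap {R S : Type*} [CommRing R] [CommRing S] [Algebra k R] [Algebra k S]
    (φ : R →ₐ[k] S) (i : ℕ) {m : ℕ} (hm : m ≤ n)
    (f : (F.map (algebraMap k R)).autFiltration i) :
    (F.filtMap φ i f).1.toTruncEnd.coeff m = φ (f.1.toTruncEnd.coeff m) :=
  coeff_map (φ : R →+* S) (by simpa using hm) _

/-- The group isomorphism `A_i / A_{i+1} ≃ G` induced by a surjection `A_i → G` with kernel
`A_{i+1}`. -/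
def grEquiv {R : Type*} [CommRing R] {F : BudLaw n R} {i : ℕ} {G : Type*} [Group G]
    (ψ : F.autFiltration i →* G) (hker : ∀ f, ψ f = 1 ↔ f.1 ∈ F.autFiltration (i + 1))
    (hsurj : Function.Surjective ψ) : F.Gr i ≃* G :=
  (QuotientGroup.quotientMulEquivOfEq (by
    ext f
    rw [Subgroup.mem_subgroupOf, MonoidHom.mem_ker, hker])).trans
    (QuotientGroup.quotientKerEquivOfSurjective ψ hsurj)

/-- A presentation of the functor `A_i / A_{i+1}` by natural surjections on `A_i` with kernel
`A_{i+1}`. -/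
def grIso {i : ℕ} (G : CommAlgCat.{u} k ⥤ GrpCat.{u})
    (ψ : ∀ A : CommAlgCat.{u} k, (F.map (algebraMap k A)).autFiltration i →* G.obj A)
    (hker : ∀ A f, ψ A f = 1 ↔ f.1 ∈ (F.map (algebraMap k A)).autFiltration (i + 1))
    (hsurj : ∀ A, Function.Surjective (ψ A))
    (hnat : ∀ (A B : CommAlgCat.{u} k) (φ : A ⟶ B) f,
      ψ B (F.filtMap φ.hom i f) = G.map φ (ψ A f)) :
    F.grFunctor i ≅ G :=
  NatIso.ofComponents (fun A => (grEquiv (ψ A) (hker A) (hsurj A)).toGrpIso) (by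
    intro A B φ
    ext x
    obtain ⟨f, rfl⟩ := QuotientGroup.mk_surjective x
    exact hnat A B φ f)

end

section

variable {n : ℕ} {R : Type*} [CommRing R] (F : BudLaw n R)

/-- The multiplier `f ↦ a₁`. -/
def multiplier (hn : 1 ≤ n) : F.Aut →* Rˣ :=
  Units.map
    { toFun := fun f : F.End => (f : TruncEnd n R).coeff 1
      map_one' := (coeff_single_T hn).trans (if_pos rfl)
      map_mul' := fun f g => coeff_one_comp hn (f : TruncEnd n R).poly (g : TruncEnd n R).poly }

/-- The coefficient `a_{i+1}`, as a homomorphism on `A_i` for `i ≥ 1`. -/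
def leadCoeff {i : ℕ} (hi : 1 ≤ i) (hn : i + 1 ≤ n) : F.autFiltration i →* Multiplicative R where
  toFun f := Multiplicative.ofAdd (f.1.toTruncEnd.coeff (i + 1))
  map_one' := by
    refine congrArg Multiplicative.ofAdd ?_
    exact (coeff_single_T hn).trans (if_neg (by omega))
  map_mul' f g := congrArg Multiplicative.ofAdd (F.coeff_succ_mul hi hn f.2 g.2)

end

section

variable {n p h : ℕ} [Fact p.Prime] (F : BudLaw n (ZMod p))

/-- As `p^h ≤ n`, the Frobenius constraint applies to `a₁`; being a unit, `a₁` is a root of unity,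
and `exists_aut_coeff_one` realises each one. -/
lemma exists_grIso_mu (hq : p ^ h ≠ 0)
    (hF : F.nsum (T ()) p = powAug (T ()) (p ^ h) hq) (hn : p ^ h ≤ n) :
    ∃ e : F.grFunctor 0 ≅ muFunctor.{u} p h, ∀ (A : CommAlgCat.{u} (ZMod p))
      (f : (F.filtFunctor 0).obj A),
      muVal (e.hom.app A ((F.grProj 0).app A f)) = F.filtCoeff 0 A f := by
  have hn1 : 1 ≤ n := (Nat.pos_of_ne_zero hq).trans_le hn
  have hmem : ∀ (A : CommAlgCat.{u} (ZMod p)) (f : (F.map (algebraMap (ZMod p) A)).Aut),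
      (F.map (algebraMap (ZMod p) A)).multiplier hn1 f ∈ rootsOfUnity (p ^ h - 1) A := by
    intro A f
    have h1 := coeff_pow_eq_of_defect F hq hF (algebraMap (ZMod p) A) (defect_aut _ f) (i := 1)
      (by omega)
    rw [mem_rootsOfUnity, ← mul_left_inj ((F.map (algebraMap (ZMod p) A)).multiplier hn1 f),
      ← pow_succ, Nat.sub_add_cancel (Nat.pos_of_ne_zero hq), one_mul]
    exact Units.ext h1
  refine ⟨F.grIso (muFunctor p h) (fun A => ((((F.map (algebraMap (ZMod p) A)).multiplier
    hn1).codRestrict (rootsOfUnity (p ^ h - 1) A) (hmem A)).comp (Subgroup.subtype _) :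
      _ →* rootsOfUnity (p ^ h - 1) A)) ?_ ?_ ?_, fun A f => rfl⟩
  · intro A f
    rw [mem_autFiltration_one_iff _ hn1]
    refine Subtype.ext_iff.trans (Units.ext_iff.trans ?_)
    rfl
  · intro A (x : rootsOfUnity (p ^ h - 1) A)
    obtain ⟨f, hf⟩ := exists_aut_coeff_one F hq hF (algebraMap (ZMod p) A) hn1 (x : Aˣ)
      (Units.isUnit _) (by
        have h1 := (mem_rootsOfUnity _ _).1 x.2
        have h2 := congrArg (· * (x : Aˣ)) h1
        simp only [one_mul, ← pow_succ, Nat.sub_add_cancel (Nat.pos_of_ne_zero hq)] at h2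
        exact congrArg Units.val h2)
    exact ⟨⟨f, mem_autFiltration_zero _ f⟩, Subtype.ext (Units.ext hf)⟩
  · intro A B φ f
    exact Subtype.ext (Units.ext (F.coeff_filtMap φ.hom 0 hn1 f))

/-- The bound `n < p^(j+h)` means `n / p^j < p^h`, the range in which the construction meets no
obstruction, so every `a` occurs. -/
lemma exists_grIso_ga (hq : p ^ h ≠ 0)
    (hF : F.nsum (T ()) p = powAug (T ()) (p ^ h) hq) {j : ℕ} (hj : 1 ≤ j) (hn : p ^ j ≤ n) (hj' : n < p ^ (j + h)) :
    ∃ e : F.grFunctor (p ^ j - 1) ≅ gaFunctor.{u} p, ∀ (A : CommAlgCat.{u} (ZMod p))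
      (f : (F.filtFunctor (p ^ j - 1)).obj A),
      gaVal (e.hom.app A ((F.grProj (p ^ j - 1)).app A f)) = F.filtCoeff (p ^ j - 1) A f := by
  have hQ : 2 ≤ p ^ j := (Fact.out : p.Prime).two_le.trans (Nat.le_self_pow (by omega) p)
  refine ⟨F.grIso (gaFunctor p) (fun A => ((F.map (algebraMap (ZMod p) A)).leadCoeff
    (by omega) (by omega) : _ →* Multiplicative A)) ?_ ?_ ?_, fun A f => rfl⟩
  · intro A f
    exact (mem_autFiltration_succ_iff _ (by omega) (by omega) f.2).symm
  · intro A (x : Multiplicative A)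
    obtain ⟨f, hf, hx⟩ := exists_aut_coeff_pow F hq hF (algebraMap (ZMod p) A) hj hn
      x.toAdd (Or.inl (Nat.div_lt_of_lt_mul (by rwa [← pow_add])))
    exact ⟨⟨f, hf⟩, congrArg Multiplicative.ofAdd hx⟩
  · intro A B φ f
    exact congrArg Multiplicative.ofAdd (F.coeff_filtMap φ.hom _ (by omega) f)

/-- Here `p^h * p^j ≤ n`, so the coefficient of `T^(p^j)` is forced to be fixed by Frobenius; all
fixed elements occur. -/
lemma exists_grIso_gaFrob (hq : p ^ h ≠ 0)
    (hF : F.nsum (T ()) p = powAug (T ()) (p ^ h) hq) {j : ℕ} (hj : 1 ≤ j) (hn : p ^ (j + h) ≤ n) :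
    ∃ e : F.grFunctor (p ^ j - 1) ≅ gaFrobFunctor.{u} p h, ∀ (A : CommAlgCat.{u} (ZMod p))
      (f : (F.filtFunctor (p ^ j - 1)).obj A),
      gaFrobVal (e.hom.app A ((F.grProj (p ^ j - 1)).app A f)) =
        F.filtCoeff (p ^ j - 1) A f := by
  have hQ : 2 ≤ p ^ j := (Fact.out : p.Prime).two_le.trans (Nat.le_self_pow (by omega) p)
  have hn' : p ^ j ≤ n :=
    (Nat.pow_le_pow_right (Fact.out : p.Prime).pos (Nat.le_add_right j h)).trans hn
  have hmem : ∀ (A : CommAlgCat.{u} (ZMod p))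
      (f : (F.map (algebraMap (ZMod p) A)).autFiltration (p ^ j - 1)),
      f.1.toTruncEnd.coeff (p ^ j - 1 + 1) ∈ frobFixed p h A := by
    intro A f
    refine coeff_pow_eq_of_defect F hq hF (algebraMap (ZMod p) A) (defect_aut _ f.1) ?_
    rwa [Nat.sub_add_cancel (by omega), mul_comm, ← pow_add]
  refine ⟨F.grIso (gaFrobFunctor p h) (fun A =>
    ({ toFun := fun f => Multiplicative.ofAdd ⟨_, hmem A f⟩
       map_one' := congrArg Multiplicative.ofAdd (Subtype.ext (congrArg Multiplicative.toAdd
        ((F.map (algebraMap (ZMod p) A)).leadCoeff (i := p ^ j - 1) (by omega)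
          (by omega)).map_one))
       map_mul' := fun f g => congrArg Multiplicative.ofAdd (Subtype.ext
        (coeff_succ_mul _ (by omega) (by omega) f.2 g.2)) } :
      _ →* Multiplicative (frobFixed p h A))) ?_ ?_ ?_, fun A f => rfl⟩
  · intro A f
    rw [mem_autFiltration_succ_iff _ (by omega) (by omega) f.2]
    exact Subtype.ext_iff (p := (· ∈ frobFixed p h A))
  · intro A (x : Multiplicative (frobFixed p h A))
    obtain ⟨f, hf, hx⟩ := exists_aut_coeff_pow F hq hF (algebraMap (ZMod p) A) hj hn'
      (x.toAdd : A) (Or.inr x.toAdd.2)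
    exact ⟨⟨f, hf⟩, congrArg Multiplicative.ofAdd (Subtype.ext hx)⟩
  · intro A B φ f
    exact congrArg Multiplicative.ofAdd
      (Subtype.ext (F.coeff_filtMap φ.hom _ (by omega) f))

lemma nonempty_grIso_trivial {i : ℕ} (hi : 1 ≤ i) (hn : i + 1 ≤ n)
    (hpow : ∀ j, i + 1 ≠ p ^ j) :
    Nonempty (F.grFunctor i ≅
      (Functor.const (CommAlgCat.{u} (ZMod p))).obj (GrpCat.of PUnit.{u + 1})) := by
  refine ⟨F.grIso _ (fun A => (1 : _ →* PUnit.{u + 1})) ?_ (fun A x => ⟨1, rfl⟩)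
    (fun A B φ f => rfl)⟩
  intro A f
  refine iff_of_true rfl ?_
  rw [mem_autFiltration_succ_iff _ hi hn f.2]
  have hp : (p : A) = 0 := by rw [← map_natCast (algebraMap (ZMod p) A)]; simp
  exact coeff_succ_eq_zero _ hp hi hn hpow f.2

end

end BudLaw

end

/-- Each isomorphism of presheaves of groups below is induced by
`f(T) ↦` the coefficient of `T^(i+1)` in `f(T)`, for `f ∈ A_i`. -/
theorem mainTheorem5 (p : ℕ) [Fact p.Prime] (h : ℕ) (hh : 1 ≤ h)
    (H : FormalGroup (ZMod p)) [H.IsComm]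
    (hH : H.mulSeries p = (PowerSeries.X : PowerSeries (ZMod p)) ^ p ^ h)
    (n l : ℕ) (hn : p ^ (h + 1) ≤ n) (hl : p ^ l ≤ n) (hl' : n < p ^ (l + 1)) :
    (∃ e : autGr.{u} (H.truncation n) 0 ≅ globalSections p ⋙ muFunctor p h,
      ∀ (S : (SchOverFp.{u} p)ᵒᵖ) (f : (autFilt (H.truncation n) 0).obj S),
        muVal (e.hom.app S (autGrMk (H.truncation n) 0 S f)) =
          autCoeff (H.truncation n) 0 S f) ∧
    (∀ j : ℕ, 1 ≤ j → j + h ≤ l →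
      ∃ e : autGr.{u} (H.truncation n) (p ^ j - 1) ≅ globalSections p ⋙ gaFrobFunctor p h,
        ∀ (S : (SchOverFp.{u} p)ᵒᵖ) (f : (autFilt (H.truncation n) (p ^ j - 1)).obj S),
          gaFrobVal (e.hom.app S (autGrMk (H.truncation n) (p ^ j - 1) S f)) =
            autCoeff (H.truncation n) (p ^ j - 1) S f) ∧
    (∀ j : ℕ, l < j + h → j ≤ l →
      ∃ e : autGr.{u} (H.truncation n) (p ^ j - 1) ≅ globalSections p ⋙ gaFunctor p,
        ∀ (S : (SchOverFp.{u} p)ᵒᵖ) (f : (autFilt (H.truncation n) (p ^ j - 1)).obj S),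
          gaVal (e.hom.app S (autGrMk (H.truncation n) (p ^ j - 1) S f)) =
            autCoeff (H.truncation n) (p ^ j - 1) S f) ∧
    (∀ i : ℕ, i < n → (∀ j : ℕ, j ≤ l → i ≠ p ^ j - 1) →
      Nonempty (autGr.{u} (H.truncation n) i ≅
        (Functor.const (SchOverFp.{u} p)ᵒᵖ).obj (GrpCat.of PUnit.{u + 1}))) := by
  have hp : p.Prime := Fact.out
  have hq : p ^ h ≠ 0 := pow_ne_zero _ hp.ne_zero
  have hF := H.nsum_truncation_eq_powAug hq hH n
  -- Ensures that `l < j + h` excludes `j = 0` in the third case.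
  have hhl : h < l := Nat.lt_of_succ_lt_succ
    ((Nat.pow_lt_pow_iff_right hp.one_lt).1 (hn.trans_lt hl'))
  refine ⟨?_, ?_, ?_, ?_⟩
  · obtain ⟨e, he⟩ := BudLaw.exists_grIso_mu.{u} _ hq hF
      ((Nat.pow_le_pow_right hp.pos (Nat.le_succ h)).trans hn)
    exact ⟨Functor.isoWhiskerLeft (globalSections p) e, fun S f => he _ f⟩
  · intro j hj hjl
    obtain ⟨e, he⟩ := BudLaw.exists_grIso_gaFrob.{u} _ hq hF hj
      ((Nat.pow_le_pow_right hp.pos hjl).trans hl)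
    exact ⟨Functor.isoWhiskerLeft (globalSections p) e, fun S f => he _ f⟩
  · intro j hlj hjl
    obtain ⟨e, he⟩ := BudLaw.exists_grIso_ga.{u} _ hq hF (j := j) (by omega)
      ((Nat.pow_le_pow_right hp.pos hjl).trans hl)
      (hl'.trans_le (Nat.pow_le_pow_right hp.pos hlj))
    exact ⟨Functor.isoWhiskerLeft (globalSections p) e, fun S f => he _ f⟩
  · intro i hin hi
    -- Exponents `j > l` need no hypothesis, because `i + 1 ≤ n < p^(l+1)`. The exponent `j = 0`
    -- excludes `i = 0`.
    have hpow : ∀ j, i + 1 ≠ p ^ j := by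
      intro j hj
      refine hi j (Nat.lt_succ_iff.1 ((Nat.pow_lt_pow_iff_right hp.one_lt).1
        (lt_of_le_of_lt ?_ hl'))) (by omega)
      omega
    have hi1 : 1 ≤ i := by
      have := hpow 0
      rw [pow_zero] at this
      omega
    obtain ⟨e⟩ := BudLaw.nonempty_grIso_trivial.{u} (H.truncation n) hi1 hin hpow
    exact ⟨Functor.isoWhiskerLeft (globalSections p) e⟩
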